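/- Let $n\ge 1$ and let $H=H(p,y):\mathbb{R}^n\times\mathbb{R}^n\to\mathbb{R}$ be convex in $p$ for every $y$, coercive in the sense that $\lim_{|p|\to\infty}\inf_{y\in\mathbb{R}^n}H(p,y)=+\infty$, and, for every $R>0$, uniformly continuous and bounded on $B_R\times\mathbb{R}^n$, where $B_R$ is the open ball of radius $R$ centred at $0$. Differential equations and inequalities are understood in the viscosity sense. For $p\in\mathbb{R}^n$ let $\overline H(p)$ be the infimum of all $\mu\in\mathbb{R}$ for which there is a Lipschitz function $w:\mathbb{R}^n\to\mathbb{R}$ with $H(p+Dw,y)\le\mu$ in $\mathbb{R}^n$ and $\lim_{|y|\to\infty}|y|^{-1}w(y)=0$. For $\mu>\min\overline H$ and $x_0\in\mathbb{R}^n$, a distance function at level $\mu$ with vertex $x_0$ is a function of the form $y\mapsto d'(y)+p_*\cdot(y-x_0)$, where $\overline H(p_*)=\min\overline H$ and $d'\in C(\mathbb{R}^n)$ solves $H(p_*+Dd',y)=\mu$ in $\mathbb{R}^n\setminus\{x_0\}$ with $d'(x_0)=0$ and $\liminf_{|y|\to\infty}|y|^{-1}d'(y)>0$. Write $V\Subset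 U$ if $V$ is open, $\overline V$ is compact and $\overline V\subseteq U$. Let $U\subseteq\mathbb{R}^n$ be open and let $u$ be an absolute subminimizer for $H$ in $U$: $u:U\to\mathbb{R}$ is locally Lipschitz, and for every $V\Subset U$ and every Lipschitz $v:\overline V\to\mathbb{R}$ with $v\le u$ in $V$ and $v=u$ on $\partial V$, $$\operatorname*{ess\,sup}_{x\in V}H(Du(x),x)\le\operatorname*{ess\,sup}_{x\in V}H(Dv(x),x).$$ Then for every $\mu>\min\overline H$ and $x_0\in\mathbb{R}^n$ there is exactly one distance function $d_{\mu,x_0}$ at level $\mu$ with vertex $x_0$, and $u$ satisfies comparisons with distance functions from above in $U$: for every $\mu>\min\overline H$, every nonempty $V\Subset U$ and every $x_0\in\mathbb{R}^n\setminus V$, $$\max_{x\in\overline V}\big(u(x)-d_{\mu,x_0}(x)\big)=\max_{x\in\partial V}\big(u(x)-d_{\mu,x_0}(x)\big).$$ -/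

import Mathlib

open Set Filter Topology MeasureTheory

noncomputable section

namespace LInfVar

/-- The Euclidean space `ℝⁿ` (Euclidean norm and inner product). -/
abbrev Space (n : ℕ) : Type := EuclideanSpace ℝ (Fin n)

variable {n : ℕ}

/-! ### Hypotheses on the Hamiltonian `H = H(p, y)` -/

/-- `p ↦ H(p, y)` is convex for every `y`. -/
def ConvexInMomentum (H : Space n → Space n → ℝ) : Prop :=
  ∀ y, ConvexOn ℝ univ fun p => H p y

/-- `inf_y H(p, y) → +∞` as `|p| → ∞`, i.e. for every `M` one has `inf_y H(p, y) ≥ M` as soon as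
`|p|` is large enough. -/
def CoerciveInMomentum (H : Space n → Space n → ℝ) : Prop :=
  ∀ M : ℝ, ∃ R : ℝ, ∀ p, R ≤ ‖p‖ → ∀ y, M ≤ H p y

/-- For every `R > 0`, `H` is uniformly continuous and bounded on `B_R × ℝⁿ`. -/
def UniformlyRegular (H : Space n → Space n → ℝ) : Prop :=
  ∀ R : ℝ, 0 < R →
    UniformContinuousOn (fun q : Space n × Space n => H q.1 q.2) (Metric.ball 0 R ×ˢ univ) ∧
    ∃ C : ℝ, ∀ p ∈ Metric.ball (0 : Space n) R, ∀ y, |H p y| ≤ C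

/-! ### Viscosity solutions of `F(Du, x) = μ` in an open set `O` -/

/-- `u` is a viscosity subsolution of `F(Du, x) ≤ μ` in the open set `O`. -/
def IsViscSubsolution (F : Space n → Space n → ℝ) (μ : ℝ) (O : Set (Space n))
    (u : Space n → ℝ) : Prop :=
  UpperSemicontinuousOn u O ∧
    ∀ φ : Space n → ℝ, ContDiff ℝ 1 φ → ∀ x ∈ O,
      IsLocalMax (fun y => u y - φ y) x → F (gradient φ x) x ≤ μ

/-- `u` is a viscosity supersolution of `F(Du, x) ≥ μ` in the open set `O`. -/
def IsViscSupersolution (F : Space n → Space n → ℝ) (μ : ℝ) (O : Set (Space n))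
    (u : Space n → ℝ) : Prop :=
  LowerSemicontinuousOn u O ∧
    ∀ φ : Space n → ℝ, ContDiff ℝ 1 φ → ∀ x ∈ O,
      IsLocalMin (fun y => u y - φ y) x → μ ≤ F (gradient φ x) x

/-- `u` is a viscosity solution of `F(Du, x) = μ` in the open set `O`. -/
def IsViscSolution (F : Space n → Space n → ℝ) (μ : ℝ) (O : Set (Space n))
    (u : Space n → ℝ) : Prop :=
  IsViscSubsolution F μ O u ∧ IsViscSupersolution F μ O u

/-! ### The effective Hamiltonian -/

/-- The levels `μ` for which `H(p + Dw, y) ≤ μ` has a global Lipschitz (viscosity) subsolution `w`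
that is strictly sublinear at infinity. -/
def subsolutionLevels (H : Space n → Space n → ℝ) (p : Space n) : Set ℝ :=
  {μ | ∃ w : Space n → ℝ, (∃ K, LipschitzWith K w) ∧
    IsViscSubsolution (fun q y => H (p + q) y) μ univ w ∧
    Tendsto (fun y => ‖y‖⁻¹ * w y) (cocompact (Space n)) (𝓝 0)}

/-- The effective Hamiltonian. -/
def effectiveH (H : Space n → Space n → ℝ) (p : Space n) : ℝ :=
  sInf (subsolutionLevels H p)

/-! ### Distance functions -/

/-- `d` is a (continuous, viscosity) solution of `H(p + Dd, y) = μ` in `ℝⁿ ∖ {x₀}` with `d(x₀) = 0`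
and `liminf_{|y| → ∞} d(y) / |y| > 0` (the liminf is taken in the extended reals). -/
def IsShiftedDistance (H : Space n → Space n → ℝ) (p : Space n) (μ : ℝ) (x₀ : Space n)
    (d : Space n → ℝ) : Prop :=
  Continuous d ∧ d x₀ = 0 ∧
    IsViscSolution (fun q y => H (p + q) y) μ {x₀}ᶜ d ∧
    (0 : EReal) < liminf (fun y => ((‖y‖⁻¹ * d y : ℝ) : EReal)) (cocompact (Space n))

/-- `d(y) = d'(y) + p_* · (y - x₀)`, where `p_*` is a minimum point of the effective Hamiltonian
and `d'` is the solution `IsShiftedDistance` for `p_*`. -/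
def IsDistanceFunction (H : Space n → Space n → ℝ) (μ : ℝ) (x₀ : Space n)
    (d : Space n → ℝ) : Prop :=
  ∃ pstar : Space n, (∀ p, effectiveH H pstar ≤ effectiveH H p) ∧
    ∃ d' : Space n → ℝ, IsShiftedDistance H pstar μ x₀ d' ∧
      ∀ y, d y = d' y + inner ℝ pstar (y - x₀)

/-- The distance function `d_{μ,x₀}`: the function satisfying `IsDistanceFunction H μ x₀`. -/
def distanceFunction (H : Space n → Space n → ℝ) (μ : ℝ) (x₀ : Space n) : Space n → ℝ :=
  Classical.epsilon (IsDistanceFunction H μ x₀)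

/-! ### Absolute subminimizers and comparison with distance functions -/

/-- `V` is open and compactly contained in `U`. -/
def CompactlyInside (V U : Set (Space n)) : Prop :=
  IsOpen V ∧ IsCompact (closure V) ∧ closure V ⊆ U

/-- `ess sup_{x ∈ V} H(Du(x), x)`, as an extended real number. By Rademacher's theorem `Du` exists
almost everywhere for the locally Lipschitz functions it is used for. -/
def energy (H : Space n → Space n → ℝ) (V : Set (Space n)) (u : Space n → ℝ) : EReal :=
  essSup (fun x => (H (gradient u x) x : EReal)) (volume.restrict V)

/-- `u` is absolutely subminimizing for `H` in `U`. -/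
def IsAbsSubminimizer (H : Space n → Space n → ℝ) (U : Set (Space n)) (u : Space n → ℝ) : Prop :=
  LocallyLipschitzOn U u ∧
    ∀ V, CompactlyInside V U → ∀ v : Space n → ℝ, (∃ K, LipschitzOnWith K v (closure V)) →
      (∀ x ∈ V, v x ≤ u x) → (∀ x ∈ frontier V, v x = u x) →
      energy H V u ≤ energy H V v

/-- `u` satisfies comparisons with distance functions from above with respect to `H` in `U`:
`u - d_{μ,x₀}` has a maximum over `closure V` and one over `∂V`, and the two are equal. -/
def ComparisonFromAbove (H : Space n → Space n → ℝ) (U : Set (Space n))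
    (u : Space n → ℝ) : Prop :=
  ∀ μ : ℝ, (⨅ p, effectiveH H p) < μ → ∀ V, CompactlyInside V U → V.Nonempty → ∀ x₀ ∉ V,
    ∃ m : ℝ, IsGreatest ((fun x => u x - distanceFunction H μ x₀ x) '' closure V) m ∧
      IsGreatest ((fun x => u x - distanceFunction H μ x₀ x) '' frontier V) m

end LInfVar

end

/-! Everything rests on one comparison (`sub_le_of_strict_subsolution`): on a bounded open set, a
Lipschitz function satisfying H(Dz, y) ≤ c < μ almost everywhere stays below a supersolution at
level μ if it does so on the boundary. By convexity of H in p and Jensen's inequality, mollifying z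
gives a C¹ function that is still a strict subsolution (`exists_contDiff_approx`), and this function
is itself a test function for the supersolution. Strictness always comes from the same source: μ >
min H̄ provides a subsolution s at a level μ₀ < μ, the combination θv + (1-θ)s is strict by
convexity, and θ → 1 at the end.

Existence is Perron's method: the supremum m of the subsolutions at level μ vanishing at x₀ solves
the equation off x₀. A corrector for p_* at a level below μ also serves all slopes within δ of p_*,
so m - p_*·(y - x₀) grows at least like δ|y - x₀| up to a sublinear error.

Uniqueness: if d₁, d₂ are distance functions, min(d₂, d₁ + 1) is mixed with an s of asymptotic slope
p_*. Since d₁ - s grows linearly, the mixture is below d₁ outside a large ball and at x₀, hence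
everywhere.

Comparison from above: let k be the boundary maximum of u - d and W = {u - d > k} in V. On W the
function d + k is an admissible competitor of energy at most μ, so the subminimizer satisfies H(Du,
y) ≤ μ almost everywhere there, and the comparison forces W to be empty
(`IsAbsSubminimizer.sub_le`). -/

noncomputable section

namespace LInfVar

variable {n : ℕ} {H : Space n → Space n → ℝ}

/-! ### Calculus of gradients -/

section Gradient

variable {f g : Space n → ℝ} {a b x x₀ : Space n}

theorem hasGradientAt_add (hf : HasGradientAt f a x) (hg : HasGradientAt g b x) :
    HasGradientAt (fun y => f y + g y) (a + b) x := by
  rw [hasGradientAt_iff_hasFDerivAt] at *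
  simpa using HasFDerivAt.fun_add hf hg

theorem hasGradientAt_const_mul (hf : HasGradientAt f a x) (c : ℝ) :
    HasGradientAt (fun y => c * f y) (c • a) x := by
  rw [hasGradientAt_iff_hasFDerivAt] at *
  simpa using HasFDerivAt.const_mul hf c

theorem hasGradientAt_sub (hf : HasGradientAt f a x) (hg : HasGradientAt g b x) :
    HasGradientAt (fun y => f y - g y) (a - b) x := by
  rw [hasGradientAt_iff_hasFDerivAt] at *
  simpa using HasFDerivAt.fun_sub hf hg

theorem hasGradientAt_inner_sub (p x₀ x : Space n) :
    HasGradientAt (fun y => inner ℝ p (y - x₀)) p x := by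
  rw [hasGradientAt_iff_hasFDerivAt]
  have h := ((InnerProductSpace.toDual ℝ (Space n) p).hasFDerivAt (x := x - x₀)).comp x
    ((hasFDerivAt_id x).sub_const x₀)
  exact h.congr_fderiv (by ext v; simp)

theorem hasGradientAt_norm_sub_sq (x₀ x : Space n) :
    HasGradientAt (fun y => ‖y - x₀‖ ^ 2) ((2 : ℝ) • (x - x₀)) x := by
  rw [hasGradientAt_iff_hasFDerivAt]
  have h := ((hasStrictFDerivAt_norm_sq (x - x₀)).hasFDerivAt).comp x
    ((hasFDerivAt_id x).sub_const x₀)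
  exact h.congr_fderiv (by ext v; simp)

theorem hasGradientAt_norm_sub (h : x ≠ x₀) :
    HasGradientAt (fun y => ‖y - x₀‖) (‖x - x₀‖⁻¹ • (x - x₀)) x := by
  have hpos : 0 < ‖x - x₀‖ := norm_pos_iff.2 (sub_ne_zero.2 h)
  have h1 := hasGradientAt_norm_sub_sq x₀ x
  rw [hasGradientAt_iff_hasFDerivAt] at *
  have h2 := h1.sqrt (by positivity)
  simp only [Real.sqrt_sq (norm_nonneg _)] at h2
  refine h2.congr_fderiv ?_
  rw [map_smul, map_smul, smul_smul]
  congr 1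
  field_simp

/-- Differentiable functions that touch have the same gradient. -/
theorem gradient_eq_of_isLocalMax (hf : DifferentiableAt ℝ f x) (hg : DifferentiableAt ℝ g x)
    (h : IsLocalMax (fun y => f y - g y) x) : gradient f x = gradient g x := by
  have h1 := hasGradientAt_sub hf.hasGradientAt hg.hasGradientAt
  rw [hasGradientAt_iff_hasFDerivAt] at h1
  have h2 := h.hasFDerivAt_eq_zero h1
  exact sub_eq_zero.1 ((InnerProductSpace.toDual ℝ (Space n)).map_eq_zero_iff.1 h2)

theorem norm_gradient_le_of_lipschitzWith {K : NNReal} (hf : LipschitzWith K f) :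
    ‖gradient f x‖ ≤ K := by
  rw [gradient, LinearIsometryEquiv.norm_map]
  exact norm_fderiv_le_of_lipschitz ℝ hf

/-- A germ of `C¹` function extends to a global `C¹` function. -/
theorem exists_contDiff_eventuallyEq (hf : ContDiffAt ℝ 1 f x) :
    ∃ φ : Space n → ℝ, ContDiff ℝ 1 φ ∧ φ =ᶠ[𝓝 x] f := by
  obtain ⟨ρ, hρ, hball⟩ := Metric.eventually_nhds_iff_ball.1 (hf.eventually (by simp))
  let χ : ContDiffBump x := ⟨ρ / 3, ρ / 2, by positivity, by linarith⟩
  refine ⟨fun y => χ y * f y, ?_, ?_⟩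
  · rw [contDiff_iff_contDiffAt]
    intro y
    by_cases hy : y ∈ Metric.ball x ρ
    · exact χ.contDiffAt.mul (hball y hy)
    · have hy' : y ∉ tsupport χ := by
        rw [χ.tsupport_eq, Metric.mem_closedBall]
        rw [Metric.mem_ball] at hy
        change ¬ (dist y x ≤ ρ / 2)
        linarith
      have h0 : (fun y => χ y * f y) =ᶠ[𝓝 y] fun _ => 0 := by
        filter_upwards [notMem_tsupport_iff_eventuallyEq.1 hy'] with z hz
        simp [hz]
      exact contDiffAt_const.congr_of_eventuallyEq h0
  · filter_upwards [χ.eventuallyEq_one] with z hz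
    simp [hz]

end Gradient

/-! ### Mollification of almost everywhere subsolutions -/

/-- The mollification at a small scale of a Lipschitz function `z` with `H(Dz, y) ≤ c` almost
everywhere is a `C¹` function with `H(Dφ, y) ≤ c + ε`. -/
theorem exists_contDiff_approx {H : Space n → Space n → ℝ} (hconv : ConvexInMomentum H)
    (hreg : UniformlyRegular H) {z : Space n → ℝ} {K : NNReal} (hz : LipschitzWith K z)
    {W : Set (Space n)} (hW : IsOpen W) {c : ℝ}
    (hc : ∀ᵐ y, y ∈ W → H (gradient z y) y ≤ c) {S : Set (Space n)} (hS : IsCompact S)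
    (hSW : S ⊆ W) {ε : ℝ} (hε : 0 < ε) :
    ∃ φ : Space n → ℝ, ContDiff ℝ 1 φ ∧ (∀ y, |φ y - z y| ≤ ε) ∧
      ∀ y ∈ S, H (gradient φ y) y ≤ c + ε := by
  obtain ⟨δ₁, hδ₁, hH⟩ := Metric.uniformContinuousOn_iff.1
    (hreg (K + 1) (by positivity)).1 ε hε
  obtain ⟨δ₂, hδ₂, hthick⟩ := hS.exists_thickening_subset_open hW hSW
  obtain ⟨ρ, hρ, hρ₁, hρ₂, hρ₃⟩ : ∃ ρ : ℝ, 0 < ρ ∧ ρ ≤ δ₁ ∧ ρ ≤ δ₂ ∧ K * ρ ≤ ε := by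
    refine ⟨min (min δ₁ δ₂) (ε / (K + 1)), by positivity, ?_, ?_, ?_⟩
    · exact (min_le_left _ _).trans (min_le_left _ _)
    · exact (min_le_left _ _).trans (min_le_right _ _)
    · have h1 : min (min δ₁ δ₂) (ε / (K + 1)) ≤ ε / (K + 1) := min_le_right _ _
      have hK : (0 : ℝ) < K + 1 := by positivity
      rw [le_div_iff₀ hK] at h1
      have : (0 : ℝ) < min (min δ₁ δ₂) (ε / (K + 1)) := by positivity
      nlinarith
  let χ : ContDiffBump (0 : Space n) := ⟨ρ / 2, ρ, by positivity, by linarith⟩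
  have hrOut : χ.rOut = ρ := rfl
  set η : Space n → ℝ := χ.normed volume with hη
  have hη0 : ∀ t, 0 ≤ η t := fun t => χ.nonneg_normed t
  have hηc : Continuous η := χ.continuous_normed
  -- The mollifier viewed as a probability measure: averages against it stay in closed convex sets,
  -- which is the form of Jensen's inequality used below.
  let ν : Measure (Space n) := volume.withDensity fun t => ENNReal.ofReal (η t)
  have hηm : Measurable fun t => ENNReal.ofReal (η t) := by fun_prop
  have hprob : IsProbabilityMeasure ν := by
    constructor
    rw [withDensity_apply _ MeasurableSet.univ, Measure.restrict_univ,
      ← ofReal_integral_eq_lintegral_ofReal χ.integrable_normed (ae_of_all _ hη0),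
      χ.integral_normed, ENNReal.ofReal_one]
  have hac : ν ≪ volume := withDensity_absolutelyContinuous _ _
  have hsupp : ∀ᵐ t ∂ν, ‖t‖ < ρ := by
    rw [ae_withDensity_iff hηm]
    refine ae_of_all _ fun t ht => ?_
    have h1 : t ∈ Function.support η := fun h => ht (by simp [h])
    rw [hη, χ.support_normed_eq, hrOut] at h1
    simpa using h1
  let φ : Space n → ℝ := fun y => ∫ t, z (y - t) ∂ν
  have hφconv : φ = convolution η z (ContinuousLinearMap.lsmul ℝ ℝ) volume := by
    funext y
    change ∫ t, z (y - t) ∂ν = ∫ t, _ ∂volume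
    rw [integral_withDensity_eq_integral_toReal_smul hηm (ae_of_all _ fun _ => ENNReal.ofReal_lt_top)]
    refine integral_congr_ae (ae_of_all _ fun t => ?_)
    simp [ENNReal.toReal_ofReal (hη0 t)]
  have hqmp : ∀ y : Space n, ∀ {P : Space n → Prop}, (∀ᵐ x, P x) → ∀ᵐ t ∂ν, P (y - t) := by
    intro y P hP
    exact hac.ae_le ((quasiMeasurePreserving_sub_left volume y).ae hP)
  -- Differentiation under the integral: the Lipschitz constant is the dominating function, and
  -- Rademacher's theorem gives differentiability at `y - t` for almost every `t`.
  have hder : ∀ y, HasFDerivAt φ (∫ t, fderiv ℝ z (y - t) ∂ν) y ∧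
      Integrable (fun t => fderiv ℝ z (y - t)) ν := by
    intro y
    have h := hasFDerivAt_integral_of_dominated_loc_of_lip (𝕜 := ℝ) (μ := ν) (x₀ := y)
      (F := fun x t => z (x - t)) (F' := fun t => fderiv ℝ z (y - t)) (bound := fun _ => (K : ℝ))
      (s := univ) univ_mem ?_ ?_ ?_ ?_ (integrable_const _) ?_
    · exact ⟨h.2, h.1⟩
    · refine Eventually.of_forall fun x => ?_
      exact (hz.continuous.comp (continuous_const.sub continuous_id)).aestronglyMeasurable
    · refine Integrable.of_bound
        (hz.continuous.comp (continuous_const.sub continuous_id)).aestronglyMeasurable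
        (‖z y‖ + K * ρ) ?_
      filter_upwards [hsupp] with t ht
      have h1 := hz.dist_le_mul (y - t) y
      rw [dist_eq_norm, dist_eq_norm] at h1
      have h2 : ‖y - t - y‖ = ‖t‖ := by rw [sub_sub_cancel_left, norm_neg]
      have h3 := norm_le_norm_add_norm_sub' (z (y - t)) (z y)
      have h4 : (K : ℝ) * ‖y - t - y‖ ≤ K * ρ := by
        rw [h2]
        exact mul_le_mul_of_nonneg_left ht.le K.2
      linarith
    · exact ((measurable_fderiv ℝ z).comp (measurable_const.sub measurable_id)).aestronglyMeasurable
    · refine ae_of_all _ fun t => ?_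
      have hK : Real.nnabs (K : ℝ) = K := by ext; simp
      rw [hK]
      refine (LipschitzWith.of_dist_le_mul fun a b => ?_).lipschitzOnWith
      simpa using hz.dist_le_mul (a - t) (b - t)
    · filter_upwards [hqmp y hz.ae_differentiableAt] with t ht
      exact (ht.hasFDerivAt.comp y ((hasFDerivAt_id y).sub_const t)).congr_fderiv (by ext v; simp)
  refine ⟨φ, ?_, ?_, ?_⟩
  · rw [hφconv]
    exact χ.hasCompactSupport_normed.contDiff_convolution_left (n := 1) _ χ.contDiff_normed
      hz.continuous.locallyIntegrable
  · intro y
    rw [← Real.dist_eq, hφconv]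
    refine ContDiffBump.dist_normed_convolution_le hz.continuous.aestronglyMeasurable ?_
    intro x hx
    rw [hrOut, Metric.mem_ball] at hx
    exact (hz.dist_le_mul x y).trans ((mul_le_mul_of_nonneg_left hx.le K.2).trans hρ₃)
  · intro y hy
    have hcv : Convex ℝ {L : StrongDual ℝ (Space n) |
        H ((InnerProductSpace.toDual ℝ (Space n)).symm L) y ≤ c + ε} := by
      intro L₁ h₁ L₂ h₂ s t hs ht hst
      rw [mem_ofPred_eq] at h₁ h₂ ⊢
      have h := (hconv y).2 (mem_univ ((InnerProductSpace.toDual ℝ (Space n)).symm L₁))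
        (mem_univ ((InnerProductSpace.toDual ℝ (Space n)).symm L₂)) hs ht hst
      rw [map_add, map_smulₛₗ, map_smulₛₗ]
      simp only [smul_eq_mul, conj_trivial] at h ⊢
      obtain rfl : t = 1 - s := by linarith
      nlinarith [mul_le_mul_of_nonneg_left h₁ hs, mul_le_mul_of_nonneg_left h₂ ht]
    have hcont : Continuous fun p => H p y := by
      rw [← continuousOn_univ]
      exact (hconv y).continuousOn isOpen_univ
    have hcl : IsClosed {L : StrongDual ℝ (Space n) |
        H ((InnerProductSpace.toDual ℝ (Space n)).symm L) y ≤ c + ε} :=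
      isClosed_le (hcont.comp (LinearIsometryEquiv.continuous _)) continuous_const
    have hmem := hcv.integral_mem hcl (μ := ν) (f := fun t => fderiv ℝ z (y - t)) ?_ (hder y).2
    · rw [gradient, (hder y).1.fderiv]
      exact hmem
    -- The inequality is known at `y - t`; uniform continuity of H on the ball of radius `K + 1`
    -- moves its second argument to `y` at cost `ε`.
    · filter_upwards [hsupp, hqmp y hc] with t ht hct
      change H (gradient z (y - t)) y ≤ c + ε
      have hmemW : y - t ∈ W := by
        refine hthick (Metric.mem_thickening_iff.2 ⟨y, hy, ?_⟩)
        rw [dist_eq_norm, sub_sub_cancel_left, norm_neg]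
        linarith
      have hg : gradient z (y - t) ∈ Metric.ball (0 : Space n) (K + 1) := by
        rw [mem_ball_zero_iff]
        have := norm_gradient_le_of_lipschitzWith hz (x := y - t)
        linarith
      have h1 := hH (gradient z (y - t), y - t) ⟨hg, mem_univ _⟩ (gradient z (y - t), y)
        ⟨hg, mem_univ _⟩ (by
          rw [Prod.dist_eq, dist_self, max_lt_iff]
          refine ⟨hδ₁, ?_⟩
          rw [dist_eq_norm, sub_sub_cancel_left, norm_neg]
          linarith)
      rw [Real.dist_eq, abs_lt] at h1
      have h2 := hct hmemW
      simp only at h1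
      linarith

/-! ### Consequences of the hypotheses on `H` -/

theorem CoerciveInMomentum.exists_bound (hcoer : CoerciveInMomentum H) (μ : ℝ) :
    ∃ K : NNReal, ∀ p y, H p y ≤ μ → ‖p‖ ≤ K := by
  obtain ⟨R, hR⟩ := hcoer (μ + 1)
  refine ⟨R.toNNReal, fun p y hp => ?_⟩
  by_contra! hlt
  have := hR p ((Real.le_coe_toNNReal R).trans hlt.le) y
  linarith

theorem UniformlyRegular.continuous (hreg : UniformlyRegular H) :
    Continuous fun q : Space n × Space n => H q.1 q.2 := by
  rw [continuous_iff_continuousAt]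
  intro q
  have h := (hreg (‖q.1‖ + 1) (by positivity)).1.continuousOn
  refine h.continuousAt (prod_mem_nhds (Metric.isOpen_ball.mem_nhds ?_) univ_mem)
  simp

/-! ### Interior maxima -/

/-- Source of the touching points below: subtracting a penalty that dominates on the sphere traps a
maximum inside the ball. -/
theorem exists_isLocalMax_of_lt_sphere {f : Space n → ℝ} (hf : Continuous f) {x : Space n} {r : ℝ}
    (hr : 0 < r) (hlt : ∀ y, ‖y - x‖ = r → f y < f x) :
    ∃ y, ‖y - x‖ < r ∧ IsLocalMax f y ∧ ∀ z, ‖z - x‖ ≤ r → f z ≤ f y := by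
  obtain ⟨y, hy, hmax⟩ := (isCompact_closedBall x r).exists_isMaxOn
    ⟨x, Metric.mem_closedBall_self hr.le⟩ hf.continuousOn
  have hmax' : ∀ z, ‖z - x‖ ≤ r → f z ≤ f y := fun z hz => hmax (mem_closedBall_iff_norm.2 hz)
  have hyr : ‖y - x‖ < r := by
    refine lt_of_le_of_ne (mem_closedBall_iff_norm.1 hy) fun h => ?_
    have h1 := hlt y h
    have h2 := hmax' x (by simpa using hr.le)
    linarith
  refine ⟨y, hyr, ?_, hmax'⟩
  filter_upwards [Metric.isOpen_ball.mem_nhds (mem_ball_iff_norm.2 hyr)] with z hz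
  exact hmax' z (mem_ball_iff_norm.1 hz).le

/-! ### Lipschitz continuity of subsolutions -/

/-- A function satisfying `u(y) ≤ u(x) + K'|y - x| + A|y - x|²` for `y` close to `x`, at every point
`x` and for every `K' > K`, is `K`-Lipschitz. -/
theorem lipschitzWith_of_local_bound {u : Space n → ℝ} (hu : Continuous u) {K : NNReal}
    (h : ∀ x, ∀ K' : ℝ, K < K' → ∃ A : ℝ, ∀ᶠ y in 𝓝 x,
      u y ≤ u x + K' * ‖y - x‖ + A * ‖y - x‖ ^ 2) : LipschitzWith K u := by
  refine LipschitzWith.of_le_add_mul K fun y x => ?_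
  rcases eq_or_ne y x with rfl | hyx
  · simp
  set ℓ := ‖y - x‖ with hℓ
  have hℓ0 : 0 < ℓ := norm_pos_iff.2 (sub_ne_zero.2 hyx)
  let γ : ℝ → Space n := fun t => x + t • (y - x)
  have hγ : Continuous γ := by fun_prop
  -- Along the segment from `x` to `y` the quadratic term disappears from the right slopes, which
  -- are thus asymptotically at most `K * ℓ`.
  have key := image_le_of_liminf_slope_right_le_deriv_boundary (f := fun t => u (γ t)) (a := 0)
    (b := 1) (hu.comp hγ).continuousOn (B := fun t => u x + K * ℓ * t) (B' := fun _ => K * ℓ)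
    (by simp [γ]) (by fun_prop) (fun t _ => by
      simpa using (((hasDerivAt_id t).const_mul (K * ℓ : ℝ)).const_add (u x)).hasDerivWithinAt) ?_
    (right_mem_Icc.2 zero_le_one)
  · rw [dist_eq_norm]
    simpa [γ] using key
  · intro t _ r hr
    obtain ⟨K', hK', hK'r⟩ : ∃ K', (K : ℝ) < K' ∧ K' * ℓ < r := by
      obtain ⟨s, hs, hsr⟩ := exists_between hr
      exact ⟨s / ℓ, by rwa [lt_div_iff₀ hℓ0], by rwa [div_mul_cancel₀ _ hℓ0.ne']⟩
    obtain ⟨A, hA⟩ := h (γ t) K' hK'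
    have h1 : ∀ᶠ s in 𝓝 t, u (γ s) ≤ u (γ t) + K' * ‖γ s - γ t‖ + A * ‖γ s - γ t‖ ^ 2 :=
      hγ.continuousAt.eventually hA
    have h2 : ∀ᶠ s in 𝓝 t, K' * ℓ + A * ((s - t) * ℓ ^ 2) < r := by
      have hc : Continuous fun s => K' * ℓ + A * ((s - t) * ℓ ^ 2) := by fun_prop
      exact hc.continuousAt.eventually (gt_mem_nhds (by simpa using hK'r))
    refine Eventually.frequently ?_
    filter_upwards [nhdsWithin_le_nhds h1, nhdsWithin_le_nhds h2, self_mem_nhdsWithin]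
      with s hs1 hs2 hs3
    have hst : 0 < s - t := sub_pos.2 hs3
    have hnorm : ‖γ s - γ t‖ = (s - t) * ℓ := by
      have : γ s - γ t = (s - t) • (y - x) := by
        simp only [γ]
        rw [sub_smul]
        abel
      rw [this, norm_smul, Real.norm_of_nonneg hst.le]
    rw [hnorm] at hs1
    rw [slope_def_field, div_lt_iff₀ hst]
    nlinarith

/-- If test functions touching `u` from above away from `x₀` have gradients bounded by `K`, then `u`
is `K`-Lipschitz in the whole space. -/
theorem lipschitzWith_of_gradient_le {u : Space n → ℝ} (hu : Continuous u) {K : NNReal}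
    (x₀ : Space n) (h : ∀ φ : Space n → ℝ, ContDiff ℝ 1 φ → ∀ x, x ≠ x₀ →
      IsLocalMax (fun y => u y - φ y) x → ‖gradient φ x‖ ≤ K) : LipschitzWith K u := by
  refine lipschitzWith_of_local_bound hu fun x K' hK' => ?_
  have hK0 : 0 < K' := K.2.trans_lt hK'
  -- Only the punctured ball has to avoid `x₀`, so `x = x₀` is allowed: the singularity is removable
  -- for the Lipschitz bound.
  obtain ⟨r, hr, hrx⟩ : ∃ r : ℝ, 0 < r ∧ ∀ y, y ≠ x → ‖y - x‖ < r → y ≠ x₀ := by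
    rcases eq_or_ne x x₀ with rfl | hx
    · exact ⟨1, one_pos, fun y hy _ => hy⟩
    · refine ⟨‖x₀ - x‖, norm_pos_iff.2 (sub_ne_zero.2 hx.symm), fun y _ hlt hy => ?_⟩
      rw [hy] at hlt
      exact hlt.false
  obtain ⟨M, hM⟩ := (isCompact_closedBall x r).bddAbove_image hu.continuousOn
  have hM' : ∀ y, ‖y - x‖ = r → u y ≤ M := fun y hy =>
    hM (mem_image_of_mem u (mem_closedBall_iff_norm.2 hy.le))
  set A := |M - u x| / r ^ 2 with hA
  have hA0 : 0 ≤ A := by positivity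
  have hAr : A * r ^ 2 = |M - u x| := by
    rw [hA, div_mul_cancel₀]
    positivity
  obtain ⟨y, hyr, hloc, hmax⟩ := exists_isLocalMax_of_lt_sphere
    (f := fun y => u y - (K' * ‖y - x‖ + A * ‖y - x‖ ^ 2)) (by fun_prop) (x := x) hr (by
      intro y hy
      have h1 := hM' y hy
      have h2 := le_abs_self (M - u x)
      have h3 : 0 < K' * r := by positivity
      simp only [hy, hAr, sub_self, norm_zero]
      linarith)
  -- At a touching point other than the tip, the cone plus paraboloid has gradient of norm at least
  -- `K' > K`.
  have hyx : y = x := by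
    by_contra hyx
    have hv : 0 < ‖y - x‖ := norm_pos_iff.2 (sub_ne_zero.2 hyx)
    have hg := hasGradientAt_add (hasGradientAt_const_mul (hasGradientAt_norm_sub hyx) K')
      (hasGradientAt_const_mul (hasGradientAt_norm_sub_sq x y) A)
    have hcd : ContDiffAt ℝ 1 (fun y => K' * ‖y - x‖ + A * ‖y - x‖ ^ 2) y := by
      have h1 : ContDiffAt ℝ 1 (fun y => ‖y - x‖) y :=
        (contDiffAt_id.sub contDiffAt_const).norm ℝ (sub_ne_zero.2 hyx)
      exact (contDiffAt_const.mul h1).add (contDiffAt_const.mul (h1.pow 2))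
    obtain ⟨φ, hφ, hφe⟩ := exists_contDiff_eventuallyEq hcd
    have hloc' : IsLocalMax (fun y => u y - φ y) y := by
      refine hloc.congr ?_
      filter_upwards [hφe] with z hz
      rw [hz]
    have hle := h φ hφ y (hrx y hyx hyr) hloc'
    rw [hφe.gradient_eq, hg.gradient, smul_smul, smul_smul, ← add_smul, norm_smul,
      Real.norm_of_nonneg (by positivity), add_mul, mul_assoc, inv_mul_cancel₀ hv.ne'] at hle
    have : 0 ≤ A * 2 * ‖y - x‖ := by positivity
    linarith
  subst hyx
  refine ⟨A, ?_⟩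
  filter_upwards [Metric.closedBall_mem_nhds y hr] with z hz
  have := hmax z (mem_closedBall_iff_norm.1 hz)
  simp only [sub_self, norm_zero] at this
  linarith

theorem IsViscSubsolution.lipschitzWith {μ : ℝ} {K : NNReal} (hK : ∀ p y, H p y ≤ μ → ‖p‖ ≤ K)
    {x₀ : Space n} {u : Space n → ℝ} (hu : IsViscSubsolution H μ {x₀}ᶜ u) (hcont : Continuous u) :
    LipschitzWith K u :=
  lipschitzWith_of_gradient_le hcont x₀ fun φ hφ x hx hmax => hK _ _ (hu.2 φ hφ x hx hmax)

theorem IsViscSubsolution.mono {μ : ℝ} {O O' : Set (Space n)} {u : Space n → ℝ}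
    (hu : IsViscSubsolution H μ O u) (h : O' ⊆ O) : IsViscSubsolution H μ O' u :=
  ⟨hu.1.mono h, fun φ hφ x hx => hu.2 φ hφ x (h hx)⟩

theorem contDiff_inner_add_sq (q x : Space n) (A : ℝ) :
    ContDiff ℝ 1 fun y => inner ℝ q (y - x) + A * ‖y - x‖ ^ 2 := by
  have h1 : ContDiff ℝ 1 fun y : Space n => y - x := contDiff_id.sub contDiff_const
  exact (contDiff_const.inner ℝ h1).add (contDiff_const.mul (h1.norm_sq ℝ))

/-- A viscosity subsolution satisfies the inequality at its points of differentiability. -/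
theorem IsViscSubsolution.le_of_differentiableAt (hreg : UniformlyRegular H) {μ : ℝ}
    {O : Set (Space n)} (hO : IsOpen O) {u : Space n → ℝ} (hu : IsViscSubsolution H μ O u)
    (hcont : Continuous u) {x : Space n} (hx : x ∈ O) (hd : DifferentiableAt ℝ u x) :
    H (gradient u x) x ≤ μ := by
  by_contra! hlt
  set q := gradient u x with hq
  have hev := hreg.continuous.continuousAt.eventually (lt_mem_nhds (show μ < H (q, x).1 (q, x).2 from hlt))
  obtain ⟨δ, hδ, hball⟩ := Metric.eventually_nhds_iff.1 hev
  -- On the sphere the penalty `2εr` beats the linearization error `εr`, and inside its gradient is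
  -- at most `4ε = δ / 2`.
  set ε := δ / 8 with hε
  have hε0 : 0 < ε := by positivity
  have hlo := (hasGradientAt_iff_isLittleO.1 hd.hasGradientAt).def hε0
  obtain ⟨r₁, hr₁, hball₁⟩ := Metric.eventually_nhds_iff.1 (hlo.and (hO.mem_nhds hx))
  set r := min (r₁ / 2) (δ / 2) with hr
  have hr0 : 0 < r := by positivity
  have hrr₁ : r < r₁ := (min_le_left _ _).trans_lt (by linarith)
  have hrδ : r < δ := (min_le_right _ _).trans_lt (by linarith)
  obtain ⟨y, hyr, hloc, -⟩ := exists_isLocalMax_of_lt_sphere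
    (f := fun y => u y - (inner ℝ q (y - x) + 2 * ε / r * ‖y - x‖ ^ 2)) (by fun_prop) (x := x) hr0
    (by
      intro y hy
      have h1 := (hball₁ (show dist y x < r₁ by rwa [dist_eq_norm, hy])).1
      rw [hy, Real.norm_eq_abs, abs_le] at h1
      have h2 : 2 * ε / r * r ^ 2 = 2 * ε * r := by field_simp
      have h3 : 0 < ε * r := by positivity
      simp only [hy, h2, sub_self, norm_zero, inner_zero_right]
      linarith [h1.2])
  have hyO : y ∈ O := (hball₁ (show dist y x < r₁ by rw [dist_eq_norm]; linarith)).2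
  have hle := hu.2 _ (contDiff_inner_add_sq q x (2 * ε / r)) y hyO hloc
  rw [(hasGradientAt_add (hasGradientAt_inner_sub q x y)
    (hasGradientAt_const_mul (hasGradientAt_norm_sub_sq x y) (2 * ε / r))).gradient] at hle
  have hdist : dist (q + (2 * ε / r) • (2 : ℝ) • (y - x), y) (q, x) < δ := by
    rw [Prod.dist_eq, max_lt_iff]
    constructor
    · rw [dist_eq_norm, add_sub_cancel_left, smul_smul, norm_smul, Real.norm_of_nonneg (by positivity)]
      have h1 : 2 * ε / r * 2 * ‖y - x‖ ≤ 2 * ε / r * 2 * r :=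
        mul_le_mul_of_nonneg_left hyr.le (by positivity)
      have h2 : 2 * ε / r * 2 * r = 4 * ε := by field_simp; ring
      linarith
    · rw [dist_eq_norm]
      linarith
  exact absurd hle (not_le.2 (hball hdist))

theorem IsViscSubsolution.ae_le (hreg : UniformlyRegular H) {μ : ℝ}
    {O : Set (Space n)} (hO : IsOpen O) {u : Space n → ℝ} (hu : IsViscSubsolution H μ O u)
    {K : NNReal} (hK : LipschitzWith K u) : ∀ᵐ y, y ∈ O → H (gradient u y) y ≤ μ := by
  filter_upwards [hK.ae_differentiableAt] with y hy hyO
  exact hu.le_of_differentiableAt hreg hO hK.continuous hyO hy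

/-! ### Comparison of strict subsolutions with supersolutions -/

/-- The mollified `z` touches `d` from below at an interior point, where it violates the
supersolution inequality; no doubling of variables is needed. -/
theorem sub_le_of_strict_subsolution (hconv : ConvexInMomentum H) (hreg : UniformlyRegular H)
    {z d : Space n → ℝ} {K : NNReal} (hz : LipschitzWith K z) (hd : Continuous d)
    {W O : Set (Space n)} (hW : IsOpen W) (hWb : Bornology.IsBounded W) (hWO : W ⊆ O) {c μ : ℝ}
    (hcμ : c < μ) (hc : ∀ᵐ y, y ∈ W → H (gradient z y) y ≤ c) (hsup : IsViscSupersolution H μ O d)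
    {k : ℝ} (hk : ∀ y ∈ frontier W, z y - d y ≤ k) {y : Space n} (hy : y ∈ W) :
    z y - d y ≤ k := by
  by_contra! hlt
  have hzd : Continuous fun y => z y - d y := hz.continuous.sub hd
  obtain ⟨x, hx, hmax⟩ := hWb.isCompact_closure.exists_isMaxOn ⟨y, subset_closure hy⟩
    hzd.continuousOn
  set M := z x - d x with hM
  have hkM : k < M := hlt.trans_le (hmax (subset_closure hy))
  set S := closure W ∩ {y | (M + k) / 2 ≤ z y - d y} with hS
  have hScpt : IsCompact S :=
    hWb.isCompact_closure.inter_right (isClosed_le continuous_const hzd)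
  have hSW : S ⊆ W := by
    rintro y ⟨hy1, hy2⟩
    by_contra hyW
    have h1 := hk y (by rw [hW.frontier_eq]; exact ⟨hy1, hyW⟩)
    have h2 : (M + k) / 2 ≤ z y - d y := hy2
    linarith
  have hxS : x ∈ S := ⟨hx, show (M + k) / 2 ≤ z x - d x by linarith⟩
  -- The first bound keeps the maximizer of `φ - d` over `S` strictly above the level `(M + k) / 2`,
  -- so that it is a local maximum; the second gives `c + ε < μ`.
  set ε := min ((M - k) / 8) ((μ - c) / 2) with hε
  have hε0 : 0 < ε := lt_min (by linarith) (by linarith)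
  have hε1 : ε ≤ (M - k) / 8 := min_le_left _ _
  have hε2 : ε ≤ (μ - c) / 2 := min_le_right _ _
  obtain ⟨φ, hφ, hφz, hφH⟩ := exists_contDiff_approx hconv hreg hz hW hc hScpt hSW hε0
  obtain ⟨y', hy', hmax'⟩ := hScpt.exists_isMaxOn ⟨x, hxS⟩ (hφ.continuous.sub hd).continuousOn
  have h1 : φ x - d x ≤ φ y' - d y' := hmax' hxS
  have h2 := abs_le.1 (hφz x)
  have h3 := abs_le.1 (hφz y')
  have h4 : (M + k) / 2 < z y' - d y' := by linarith
  have hmin : IsLocalMin (fun y => d y - φ y) y' := by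
    filter_upwards [hW.mem_nhds (hSW hy'), hzd.continuousAt.eventually (lt_mem_nhds h4)] with w hw hw'
    have h5 : φ w - d w ≤ φ y' - d y' :=
      hmax' (show w ∈ S from ⟨subset_closure hw, hw'.le⟩)
    linarith
  have h6 := hsup.2 φ hφ y' (hWO (hSW hy')) hmin
  have h7 := hφH y' hy'
  linarith

theorem exists_norm_le_imp_of_cocompact {P : Space n → Prop}
    (h : ∀ᶠ y in cocompact (Space n), P y) : ∃ R : ℝ, ∀ y, R ≤ ‖y‖ → P y := by
  rw [← Metric.cobounded_eq_cocompact, ← comap_norm_atTop] at h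
  obtain ⟨s, hs, hsP⟩ := mem_comap.1 h
  obtain ⟨R, hR⟩ := mem_atTop_sets.1 hs
  exact ⟨R, fun y hy => hsP (hR _ hy)⟩

/-! ### Elementary operations on sub- and supersolutions -/

section Operations

variable {F : Space n → Space n → ℝ} {p : Space n} {μ : ℝ} {O : Set (Space n)} {w : Space n → ℝ}

theorem continuous_inner_sub (p x₀ : Space n) : Continuous fun y => inner ℝ p (y - x₀) := by
  fun_prop

theorem contDiff_sub_inner {φ : Space n → ℝ} (hφ : ContDiff ℝ 1 φ) (p x₀ : Space n) :
    ContDiff ℝ 1 fun y => φ y - inner ℝ p (y - x₀) :=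
  hφ.sub (contDiff_const.inner ℝ (contDiff_id.sub contDiff_const))

theorem gradient_sub_inner {φ : Space n → ℝ} (hφ : ContDiff ℝ 1 φ) (p x₀ x : Space n) :
    gradient (fun y => φ y - inner ℝ p (y - x₀)) x = gradient φ x - p :=
  (hasGradientAt_sub (hφ.differentiable one_ne_zero x).hasGradientAt
    (hasGradientAt_inner_sub p x₀ x)).gradient

theorem IsViscSubsolution.add_inner (x₀ : Space n)
    (hw : IsViscSubsolution (fun q y => F (p + q) y) μ O w) :
    IsViscSubsolution F μ O fun y => w y + inner ℝ p (y - x₀) := by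
  refine ⟨hw.1.add (continuous_inner_sub p x₀).continuousOn.upperSemicontinuousOn,
    fun φ hφ x hx hmax => ?_⟩
  have h := hw.2 _ (contDiff_sub_inner hφ p x₀) x hx (by
    convert hmax using 2
    ring)
  simpa only [gradient_sub_inner hφ, add_sub_cancel] using h

theorem IsViscSupersolution.add_inner (x₀ : Space n)
    (hw : IsViscSupersolution (fun q y => F (p + q) y) μ O w) :
    IsViscSupersolution F μ O fun y => w y + inner ℝ p (y - x₀) := by
  refine ⟨hw.1.add (continuous_inner_sub p x₀).continuousOn.lowerSemicontinuousOn,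
    fun φ hφ x hx hmin => ?_⟩
  have h := hw.2 _ (contDiff_sub_inner hφ p x₀) x hx (by
    convert hmin using 2
    ring)
  simpa only [gradient_sub_inner hφ, add_sub_cancel] using h

theorem IsViscSolution.sub_inner (x₀ : Space n) (hw : IsViscSolution F μ O w) (p : Space n) :
    IsViscSolution (fun q y => F (p + q) y) μ O fun y => w y - inner ℝ p (y - x₀) := by
  have h1 : IsViscSolution (fun q y => F (p + (-p + q)) y) μ O w := by simpa using hw
  have h2 := IsViscSubsolution.add_inner (F := fun q y => F (p + q) y) x₀ h1.1
  have h3 := IsViscSupersolution.add_inner (F := fun q y => F (p + q) y) x₀ h1.2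
  simp only [inner_neg_left, ← sub_eq_add_neg] at h2 h3
  exact ⟨h2, h3⟩

theorem IsViscSubsolution.sub_const (hw : IsViscSubsolution F μ O w) (c : ℝ) :
    IsViscSubsolution F μ O fun y => w y - c := by
  have hc : ContinuousOn (fun _ : Space n => -c) O := continuousOn_const
  refine ⟨by simpa only [sub_eq_add_neg] using hw.1.add hc.upperSemicontinuousOn,
    fun φ hφ x hx hmax => ?_⟩
  refine hw.2 φ hφ x hx ?_
  filter_upwards [hmax] with y hy
  linarith

theorem IsViscSubsolution.mono_level {μ' : ℝ} (hw : IsViscSubsolution F μ O w) (h : μ ≤ μ') :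
    IsViscSubsolution F μ' O w :=
  ⟨hw.1, fun φ hφ x hx hmax => (hw.2 φ hφ x hx hmax).trans h⟩

end Operations

/-! ### The effective Hamiltonian -/

theorem exists_lowerBound (hcoer : CoerciveInMomentum H) (hreg : UniformlyRegular H) :
    ∃ M : ℝ, ∀ q y, M ≤ H q y := by
  obtain ⟨R, hR⟩ := hcoer 0
  obtain ⟨C, hC⟩ := (hreg (|R| + 1) (by positivity)).2
  refine ⟨min 0 (-C), fun q y => ?_⟩
  rcases le_total R ‖q‖ with h | h
  · exact (min_le_left _ _).trans (hR q h y)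
  · have h1 := hC q (mem_ball_zero_iff.2 (by linarith [le_abs_self R])) y
    exact (min_le_right _ _).trans (abs_le.1 h1).1

theorem subsolutionLevels_nonempty (hreg : UniformlyRegular H) (p : Space n) :
    (subsolutionLevels H p).Nonempty := by
  obtain ⟨C, hC⟩ := (hreg (‖p‖ + 1) (by positivity)).2
  refine ⟨C, fun _ => 0, ⟨0, LipschitzWith.const _⟩,
    ⟨continuousOn_const.upperSemicontinuousOn, fun φ hφ x _ hmax => ?_⟩,
    by simpa using tendsto_const_nhds⟩
  have h := gradient_eq_of_isLocalMax (differentiableAt_const (0 : ℝ))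
    (hφ.differentiable one_ne_zero x) hmax
  simp only [← h, gradient_fun_const, add_zero]
  exact (abs_le.1 (hC p (by simp) x)).2

/-- Since `w` is sublinear, the wide paraboloid `|y|² / (2r)`, up to a constant, touches it from
above at a point of norm less than `r`, where its gradient has norm at most 1. -/
theorem le_of_mem_subsolutionLevels {p : Space n} {μ M : ℝ} (hμ : μ ∈ subsolutionLevels H p)
    (hM : ∀ q y, ‖q‖ ≤ 1 → M ≤ H (p + q) y) : M ≤ μ := by
  obtain ⟨w, ⟨K, hK⟩, hw, hlim⟩ := hμ
  obtain ⟨R, hR⟩ := exists_norm_le_imp_of_cocompact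
    (hlim.eventually (Metric.ball_mem_nhds 0 (show (0 : ℝ) < 1 / 8 by norm_num)))
  set r := max 1 (max R (8 * |w 0|)) with hr
  have hr1 : 1 ≤ r := le_max_left _ _
  have hr2 : R ≤ r := (le_max_left _ _).trans (le_max_right _ _)
  have hr3 : 8 * |w 0| ≤ r := (le_max_right _ _).trans (le_max_right _ _)
  have hr0 : 0 < r := by linarith
  obtain ⟨y, hyr, hloc, -⟩ := exists_isLocalMax_of_lt_sphere
    (f := fun y => w y - (inner ℝ 0 (y - 0) + 1 / (2 * r) * ‖y - 0‖ ^ 2))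
    (by have := hK.continuous; fun_prop) (x := 0) hr0 (by
      intro y hy
      rw [sub_zero] at hy
      have h1 := hR y (by rwa [hy])
      rw [dist_zero_right, norm_mul, norm_inv, norm_norm, hy, inv_mul_lt_iff₀ hr0,
        Real.norm_eq_abs, abs_lt] at h1
      have h2 : 1 / (2 * r) * r ^ 2 = r / 2 := by field_simp
      have h3 := neg_abs_le (w 0)
      simp only [sub_zero, inner_zero_left, hy, h2, norm_zero]
      linarith [h1.2])
  have h := hw.2 _ (contDiff_inner_add_sq 0 0 (1 / (2 * r))) y (mem_univ y) hloc
  rw [(hasGradientAt_add (hasGradientAt_inner_sub 0 0 y)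
    (hasGradientAt_const_mul (hasGradientAt_norm_sub_sq 0 y) (1 / (2 * r)))).gradient] at h
  refine (hM _ y ?_).trans h
  rw [zero_add, smul_smul, norm_smul, Real.norm_of_nonneg (by positivity)]
  have h4 : 1 / (2 * r) * 2 * ‖y - 0‖ ≤ 1 / (2 * r) * 2 * r :=
    mul_le_mul_of_nonneg_left hyr.le (by positivity)
  have h5 : 1 / (2 * r) * 2 * r = 1 := by field_simp
  linarith

theorem subsolutionLevels_bddBelow (hcoer : CoerciveInMomentum H) (hreg : UniformlyRegular H)
    (p : Space n) : BddBelow (subsolutionLevels H p) := by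
  obtain ⟨M, hM⟩ := exists_lowerBound hcoer hreg
  exact ⟨M, fun μ hμ => le_of_mem_subsolutionLevels hμ fun q y _ => hM _ y⟩

theorem exists_mem_subsolutionLevels_lt (hreg : UniformlyRegular H) {p : Space n} {μ : ℝ}
    (h : effectiveH H p < μ) : ∃ μ' ∈ subsolutionLevels H p, μ' < μ :=
  exists_lt_of_csInf_lt (subsolutionLevels_nonempty hreg p) h

/-- A subsolution for the momentum `p` is one for nearby momenta at a slightly higher level. -/
theorem exists_perturbation (hcoer : CoerciveInMomentum H) (hreg : UniformlyRegular H) (μ : ℝ)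
    {ε : ℝ} (hε : 0 < ε) : ∃ δ > 0, ∀ p p' : Space n, ‖p' - p‖ ≤ δ → ∀ O w,
      IsViscSubsolution (fun q y => H (p + q) y) μ O w →
        IsViscSubsolution (fun q y => H (p' + q) y) (μ + ε) O w := by
  obtain ⟨K, hK⟩ := hcoer.exists_bound μ
  obtain ⟨δ, hδ, hH⟩ := Metric.uniformContinuousOn_iff.1
    (hreg (K + 1) (by positivity)).1 ε hε
  refine ⟨min (δ / 2) (1 / 2), by positivity, fun p p' hp O w hw => ⟨hw.1, fun φ hφ x hx hmax => ?_⟩⟩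
  have h1 : H (p + gradient φ x) x ≤ μ := hw.2 φ hφ x hx hmax
  have h2 := hK _ _ h1
  have hp1 : ‖p' - p‖ ≤ δ / 2 := hp.trans (min_le_left _ _)
  have hp2 : ‖p' - p‖ ≤ 1 / 2 := hp.trans (min_le_right _ _)
  have h3 : ‖p' + gradient φ x‖ ≤ ‖p + gradient φ x‖ + ‖p' - p‖ := by
    have : p' + gradient φ x = (p + gradient φ x) + (p' - p) := by abel
    rw [this]
    exact norm_add_le _ _
  have h4 := hH (p' + gradient φ x, x) ⟨mem_ball_zero_iff.2 (by simp only; linarith), mem_univ _⟩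
    (p + gradient φ x, x) ⟨mem_ball_zero_iff.2 (by simp only; linarith), mem_univ _⟩ (by
      rw [Prod.dist_eq, dist_self, max_lt_iff]
      refine ⟨?_, hδ⟩
      rw [dist_add_right, dist_eq_norm]
      linarith)
  rw [Real.dist_eq, abs_lt] at h4
  simp only at h4
  linarith [h4.2]

/-- The radius `δ` of `exists_perturbation` depends on the level only, so a low subsolution at a
nearby `p'` can be carried back to `p`. -/
theorem lowerSemicontinuous_effectiveH (hcoer : CoerciveInMomentum H) (hreg : UniformlyRegular H) :
    LowerSemicontinuous (effectiveH H) := by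
  intro p a ha
  obtain ⟨a', haa', ha'⟩ := exists_between ha
  obtain ⟨δ, hδ, hpert⟩ := exists_perturbation hcoer hreg a'
    (ε := (effectiveH H p - a') / 2) (by linarith)
  filter_upwards [Metric.closedBall_mem_nhds p hδ] with p' hp'
  by_contra! hle
  obtain ⟨μ', ⟨w, hwK, hw, hlim⟩, hμ'⟩ := exists_mem_subsolutionLevels_lt hreg
    (show effectiveH H p' < a' from lt_of_le_of_lt hle haa')
  have hmem : a' + (effectiveH H p - a') / 2 ∈ subsolutionLevels H p :=
    ⟨w, hwK, hpert p' p (by rw [norm_sub_rev]; exact mem_closedBall_iff_norm.1 hp') _ _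
      (hw.mono_level hμ'.le), hlim⟩
  have : effectiveH H p ≤ a' + (effectiveH H p - a') / 2 :=
    csInf_le (subsolutionLevels_bddBelow hcoer hreg p) hmem
  linarith

/-- Lower semicontinuity gives a minimum on a ball and coercivity handles the outside; the extra 1
in the radius absorbs the test gradient `q`. -/
theorem exists_forall_effectiveH_le (hcoer : CoerciveInMomentum H) (hreg : UniformlyRegular H) :
    ∃ p, ∀ p', effectiveH H p ≤ effectiveH H p' := by
  obtain ⟨R, hR⟩ := hcoer (effectiveH H 0)
  obtain ⟨p, -, hp⟩ := ((lowerSemicontinuous_effectiveH hcoer hreg).lowerSemicontinuousOn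
    (Metric.closedBall 0 (|R| + 1))).exists_isMinOn
    ⟨0, Metric.mem_closedBall_self (by positivity)⟩ (isCompact_closedBall _ _)
  refine ⟨p, fun p' => ?_⟩
  rcases le_total ‖p'‖ (|R| + 1) with h | h
  · exact hp (mem_closedBall_zero_iff.2 h)
  · have h0 : effectiveH H p ≤ effectiveH H 0 := hp (Metric.mem_closedBall_self (by positivity))
    refine h0.trans (le_csInf (subsolutionLevels_nonempty hreg p') fun μ hμ => ?_)
    refine le_of_mem_subsolutionLevels hμ fun q y hq => hR _ ?_ y
    have h1 : ‖p'‖ ≤ ‖p' + q‖ + ‖q‖ := by simpa using norm_sub_le (p' + q) q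
    linarith [le_abs_self R]

/-! ### The maximal subsolution vanishing at the vertex -/

/-- Continuous subsolutions at level `μ` in the whole space that vanish at `x₀`. -/
def pointedSubsolutions (H : Space n → Space n → ℝ) (μ : ℝ) (x₀ : Space n) :
    Set (Space n → ℝ) :=
  {w | Continuous w ∧ IsViscSubsolution H μ univ w ∧ w x₀ = 0}

/-- The largest subsolution at level `μ` vanishing at `x₀`. -/
def maximalSubsolution (H : Space n → Space n → ℝ) (μ : ℝ) (x₀ y : Space n) : ℝ :=
  ⨆ w : pointedSubsolutions H μ x₀, w.1 y

section Maximal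

variable {μ : ℝ} {x₀ : Space n} {K : NNReal}

theorem lipschitzWith_of_mem_pointedSubsolutions (hK : ∀ p y, H p y ≤ μ → ‖p‖ ≤ K)
    {w : Space n → ℝ} (hw : w ∈ pointedSubsolutions H μ x₀) : LipschitzWith K w :=
  (hw.2.1.mono (subset_univ {x₀}ᶜ)).lipschitzWith hK hw.1

theorem le_maximalSubsolution (hK : ∀ p y, H p y ≤ μ → ‖p‖ ≤ K) {w : Space n → ℝ}
    (hw : w ∈ pointedSubsolutions H μ x₀) (y : Space n) : w y ≤ maximalSubsolution H μ x₀ y := by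
  refine le_ciSup (f := fun w : pointedSubsolutions H μ x₀ => w.1 y) ⟨K * dist y x₀, ?_⟩ ⟨w, hw⟩
  rintro _ ⟨v, rfl⟩
  have h := (lipschitzWith_of_mem_pointedSubsolutions hK v.2).le_add_mul y x₀
  rwa [v.2.2.2, zero_add] at h

theorem exists_lt_of_lt_maximalSubsolution
    (hne : (pointedSubsolutions H μ x₀).Nonempty) {y : Space n} {a : ℝ}
    (ha : a < maximalSubsolution H μ x₀ y) : ∃ w ∈ pointedSubsolutions H μ x₀, a < w y := by
  have := hne.to_subtype
  obtain ⟨w, hw⟩ := exists_lt_of_lt_ciSup ha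
  exact ⟨w.1, w.2, hw⟩

theorem maximalSubsolution_vertex (hne : (pointedSubsolutions H μ x₀).Nonempty) :
    maximalSubsolution H μ x₀ x₀ = 0 := by
  have := hne.to_subtype
  rw [maximalSubsolution, ← ciSup_const (ι := pointedSubsolutions H μ x₀) (a := (0 : ℝ))]
  congr 1
  funext w
  exact w.2.2.2

theorem lipschitzWith_maximalSubsolution (hne : (pointedSubsolutions H μ x₀).Nonempty)
    (hK : ∀ p y, H p y ≤ μ → ‖p‖ ≤ K) :
    LipschitzWith K (maximalSubsolution H μ x₀) := by
  have := hne.to_subtype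
  refine LipschitzWith.of_le_add_mul K fun y x => ciSup_le fun w => ?_
  have h1 := (lipschitzWith_of_mem_pointedSubsolutions hK w.2).le_add_mul y x
  have h2 := le_maximalSubsolution hK w.2 x
  linarith

/-- Adding `|y - x|²` makes the touching strict, so a single competitor within `r²` of the supremum
at `x` is touched nearby, at almost the same gradient. -/
theorem isViscSubsolution_maximalSubsolution
    (hne : (pointedSubsolutions H μ x₀).Nonempty) (hreg : UniformlyRegular H)
    (hK : ∀ p y, H p y ≤ μ → ‖p‖ ≤ K) :
    IsViscSubsolution H μ univ (maximalSubsolution H μ x₀) := by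
  set m := maximalSubsolution H μ x₀ with hm
  refine ⟨(lipschitzWith_maximalSubsolution hne hK).continuous.continuousOn.upperSemicontinuousOn,
    fun φ hφ x _ hmax => ?_⟩
  by_contra! hlt
  have hev : ∀ᶠ q in 𝓝 (gradient φ x, x), μ < H q.1 q.2 :=
    hreg.continuous.continuousAt.eventually (lt_mem_nhds hlt)
  obtain ⟨δ, hδ, hball⟩ := Metric.eventually_nhds_iff.1 hev
  have hgrad : Continuous (gradient φ) :=
    (LinearIsometryEquiv.continuous _).comp (hφ.continuous_fderiv one_ne_zero)
  have hev2 : ∀ᶠ y in 𝓝 x, dist (gradient φ y) (gradient φ x) < δ / 2 :=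
    hgrad.continuousAt.eventually (Metric.ball_mem_nhds _ (by positivity))
  obtain ⟨r₁, hr₁, hball₁⟩ := Metric.eventually_nhds_iff.1 (hev2.and hmax)
  set r := min (r₁ / 2) (δ / 4) with hr
  have hr0 : 0 < r := by positivity
  have hrr₁ : r < r₁ := (min_le_left _ _).trans_lt (by linarith)
  have hrδ : r ≤ δ / 4 := min_le_right _ _
  obtain ⟨w, hw, hwx⟩ := exists_lt_of_lt_maximalSubsolution hne
    (show m x - r ^ 2 < maximalSubsolution H μ x₀ x by
      have : 0 < r ^ 2 := by positivity
      linarith)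
  have hwm := le_maximalSubsolution hK hw
  obtain ⟨y, hyr, hloc, -⟩ := exists_isLocalMax_of_lt_sphere
    (f := fun y => w y - (φ y + 1 * ‖y - x‖ ^ 2))
    (by have h1 := hw.1; have h2 := hφ.continuous; fun_prop) (x := x) hr0 (by
      intro y hy
      have h1 := (hball₁ (show dist y x < r₁ by rwa [dist_eq_norm, hy])).2
      have h2 := hwm y
      simp only [hy, sub_self, norm_zero]
      simp only at h1
      linarith)
  have hsq : ContDiff ℝ 1 fun y => φ y + 1 * ‖y - x‖ ^ 2 :=
    hφ.add (contDiff_const.mul ((contDiff_id.sub contDiff_const).norm_sq ℝ))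
  have hle := hw.2.1.2 _ hsq y (mem_univ y) hloc
  rw [(hasGradientAt_add (hφ.differentiable one_ne_zero y).hasGradientAt
    (hasGradientAt_const_mul (hasGradientAt_norm_sub_sq x y) 1)).gradient] at hle
  refine absurd hle (not_le.2 (hball
    (y := (gradient φ y + (1 : ℝ) • (2 : ℝ) • (y - x), y)) ?_))
  have h3 := (hball₁ (show dist y x < r₁ by rw [dist_eq_norm]; linarith)).1
  rw [Prod.dist_eq, max_lt_iff]
  constructor
  · simp only
    rw [one_smul]
    have h4 : dist (gradient φ y + (2 : ℝ) • (y - x)) (gradient φ y) = 2 * ‖y - x‖ := by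
      rw [dist_eq_norm, add_sub_cancel_left, norm_smul]
      simp
    have h5 := dist_triangle (gradient φ y + (2 : ℝ) • (y - x)) (gradient φ y) (gradient φ x)
    linarith
  · simp only
    rw [dist_eq_norm]
    linarith

/-- Perron's bump: were the inequality to fail at `x ≠ x₀`, raising `m` near `x` would give a larger
competitor. -/
theorem isViscSupersolution_maximalSubsolution
    (hne : (pointedSubsolutions H μ x₀).Nonempty) (hreg : UniformlyRegular H)
    (hK : ∀ p y, H p y ≤ μ → ‖p‖ ≤ K) :
    IsViscSupersolution H μ {x₀}ᶜ (maximalSubsolution H μ x₀) := by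
  set m := maximalSubsolution H μ x₀ with hm
  have hmc : Continuous m := (lipschitzWith_maximalSubsolution hne hK).continuous
  refine ⟨hmc.continuousOn.lowerSemicontinuousOn, fun φ hφ x hx hmin => ?_⟩
  by_contra! hlt
  have hgrad : Continuous (gradient φ) :=
    (LinearIsometryEquiv.continuous _).comp (hφ.continuous_fderiv one_ne_zero)
  let ψ : Space n → ℝ := fun y => φ y + (-1) * ‖y - x‖ ^ 2
  have hψg : ∀ y, HasGradientAt ψ (gradient φ y + (-1 : ℝ) • (2 : ℝ) • (y - x)) y := fun y =>
    hasGradientAt_add (hφ.differentiable one_ne_zero y).hasGradientAt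
      (hasGradientAt_const_mul (hasGradientAt_norm_sub_sq x y) (-1))
  have hψc : Continuous ψ := by have := hφ.continuous; fun_prop
  have hev : ∀ᶠ y in 𝓝 x, H (gradient φ y + (-1 : ℝ) • (2 : ℝ) • (y - x)) y < μ := by
    have hc : Continuous fun y => H (gradient φ y + (-1 : ℝ) • (2 : ℝ) • (y - x)) y :=
      hreg.continuous.comp (Continuous.prodMk (by fun_prop) continuous_id)
    exact hc.continuousAt.eventually (gt_mem_nhds (by simpa using hlt))
  obtain ⟨r₁, hr₁, hball⟩ := Metric.eventually_nhds_iff.1 (hev.and hmin)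
  have hxx₀ : 0 < ‖x₀ - x‖ := norm_pos_iff.2 (sub_ne_zero.2 (Ne.symm hx))
  set r := min (r₁ / 2) (‖x₀ - x‖ / 2) with hr
  have hr0 : 0 < r := by positivity
  have hrr₁ : r < r₁ := (min_le_left _ _).trans_lt (by linarith)
  have hrx₀ : r < ‖x₀ - x‖ := (min_le_right _ _).trans_lt (by linarith)
  -- Lifts `ψ` by `r² / 2` above `m` at `x`, while the term `-|y - x|²` keeps it at least `r² / 2`
  -- below on the sphere.
  set a := m x - φ x + r ^ 2 / 2 with ha
  let w : Space n → ℝ := fun y => if ‖y - x‖ ≤ r then max (m y) (ψ y + a) else m y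
  have hmw : ∀ y, m y ≤ w y := fun y => by
    by_cases hy : ‖y - x‖ ≤ r
    · simp only [w, if_pos hy]
      exact le_max_left _ _
    · simp only [w, if_neg hy, le_refl]
  have hsphere : ∀ y, ‖y - x‖ = r → ψ y + a < m y := fun y hy => by
    have h1 := (hball (show dist y x < r₁ by rwa [dist_eq_norm, hy])).2
    have h2 : 0 < r ^ 2 := by positivity
    simp only [ψ, hy, ha]
    simp only at h1
    linarith
  have hwc : Continuous w := by
    refine Continuous.if_le (hmc.max (hψc.add continuous_const)) hmc (by fun_prop)
      continuous_const fun y hy => ?_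
    exact max_eq_left (hsphere y hy).le
  have hwS : w ∈ pointedSubsolutions H μ x₀ := by
    refine ⟨hwc, ⟨hwc.continuousOn.upperSemicontinuousOn, fun χ hχ y _ hmax => ?_⟩, ?_⟩
    · rcases (hmw y).eq_or_lt with heq | hlt'
      · refine (isViscSubsolution_maximalSubsolution hne hreg hK).2 χ hχ y (mem_univ y) ?_
        filter_upwards [hmax] with v hv
        have h1 := hmw v
        change m v - χ v ≤ m y - χ y
        linarith
      · have hyr : ‖y - x‖ ≤ r := by
          by_contra hyr
          simp only [w, if_neg hyr, lt_irrefl] at hlt'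
        have hwy : w y = max (m y) (ψ y + a) := by simp only [w, if_pos hyr]
        have hψy : w y = ψ y + a := by
          rcases max_choice (m y) (ψ y + a) with h | h
          · rw [hwy, h] at hlt'
            exact absurd hlt' (lt_irrefl _)
          · rw [hwy, h]
        have hyr' : ‖y - x‖ < r := by
          refine lt_of_le_of_ne hyr fun h => ?_
          have := hsphere y h
          linarith
        have hloc : IsLocalMax (fun v => ψ v - χ v) y := by
          filter_upwards [hmax, Metric.isOpen_ball.mem_nhds (mem_ball_iff_norm.2 hyr')] with v hv hvr
          have h1 : ψ v + a ≤ w v := by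
            simp only [w, if_pos (mem_ball_iff_norm.1 hvr).le]
            exact le_max_right _ _
          linarith
        have h2 := gradient_eq_of_isLocalMax (hψg y).differentiableAt
          (hχ.differentiable one_ne_zero y) hloc
        rw [← h2, (hψg y).gradient]
        exact (hball (show dist y x < r₁ by rw [dist_eq_norm]; linarith)).1.le
    · simp only [w, if_neg (not_le.2 hrx₀)]
      exact maximalSubsolution_vertex hne
  have h1 := le_maximalSubsolution hK hwS x
  have h2 : ψ x + a ≤ w x := by
    simp only [w, sub_self, norm_zero, if_pos hr0.le]
    exact le_max_right _ _
  have h3 : 0 < r ^ 2 := by positivity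
  simp only [ψ, sub_self, norm_zero, ha] at h2
  have h4 : w x ≤ m x := h1
  linarith

end Maximal

/-- Distance functions exist at all levels above the minimum of the effective Hamiltonian. -/
theorem exists_isDistanceFunction (hcoer : CoerciveInMomentum H) (hreg : UniformlyRegular H)
    {μ : ℝ} {p : Space n} (hp : ∀ p', effectiveH H p ≤ effectiveH H p') (hμ : effectiveH H p < μ)
    (x₀ : Space n) : ∃ d, IsDistanceFunction H μ x₀ d := by
  obtain ⟨K, hK⟩ := hcoer.exists_bound μ
  obtain ⟨μ₀, ⟨w, ⟨L, hL⟩, hw, hlim⟩, hμ₀⟩ := exists_mem_subsolutionLevels_lt hreg hμ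
  obtain ⟨δ, hδ, hpert⟩ := exists_perturbation hcoer hreg μ₀ (sub_pos.2 hμ₀)
  have hmem : ∀ p', ‖p' - p‖ ≤ δ →
      (fun y => w y + inner ℝ p' (y - x₀) - w x₀) ∈ pointedSubsolutions H μ x₀ := by
    intro p' hp'
    have h := ((hpert p p' hp' _ _ hw).add_inner x₀).sub_const (w x₀)
    rw [add_sub_cancel] at h
    refine ⟨?_, h, by simp⟩
    have := hL.continuous
    fun_prop
  have hne : (pointedSubsolutions H μ x₀).Nonempty := ⟨_, hmem p (by simpa using hδ.le)⟩
  set m := maximalSubsolution H μ x₀ with hm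
  have hmc : Continuous m := (lipschitzWith_maximalSubsolution hne hK).continuous
  have hgrow : ∀ y, δ * ‖y - x₀‖ + w y - w x₀ ≤ m y - inner ℝ p (y - x₀) := by
    intro y
    rcases eq_or_ne y x₀ with rfl | hy
    · have : m y = 0 := maximalSubsolution_vertex hne
      simp [this]
    have hpos : 0 < ‖y - x₀‖ := norm_pos_iff.2 (sub_ne_zero.2 hy)
    -- The slope is tilted from `p` by `δ` in the direction of `y - x₀`, which gains `δ * ‖y - x₀‖`
    -- at `y`.
    have h := le_maximalSubsolution hK (hmem (p + (δ / ‖y - x₀‖) • (y - x₀)) (by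
      rw [add_sub_cancel_left, norm_smul, Real.norm_of_nonneg (by positivity),
        div_mul_cancel₀ _ hpos.ne'])) y
    simp only [inner_add_left, inner_smul_left, conj_trivial] at h
    rw [real_inner_self_eq_norm_sq] at h
    have h2 : δ / ‖y - x₀‖ * ‖y - x₀‖ ^ 2 = δ * ‖y - x₀‖ := by field_simp
    linarith
  refine ⟨m, p, hp, fun y => m y - inner ℝ p (y - x₀), ⟨?_, ?_, ?_, ?_⟩, fun y => by ring⟩
  · exact hmc.sub (continuous_inner_sub p x₀)
  · have : m x₀ = 0 := maximalSubsolution_vertex hne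
    simp [this]
  · exact IsViscSolution.sub_inner x₀
      ⟨(isViscSubsolution_maximalSubsolution hne hreg hK).mono (subset_univ _),
        isViscSupersolution_maximalSubsolution hne hreg hK⟩ p
  · refine lt_of_lt_of_le (b := ((δ / 2 : ℝ) : EReal)) (by exact_mod_cast half_pos hδ)
      (le_liminf_of_le (by isBoundedDefault) ?_)
    have hev1 := hlim.eventually (Metric.ball_mem_nhds 0 (show 0 < δ / 4 by positivity))
    have hev2 := (tendsto_norm_cocompact_atTop (E := Space n)).eventually_ge_atTop
      (max 1 ((δ * ‖x₀‖ + |w x₀|) / (δ / 4)))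
    filter_upwards [hev1, hev2] with y hy1 hy2
    rw [EReal.coe_le_coe_iff]
    have hy0 : 0 < ‖y‖ := lt_of_lt_of_le one_pos ((le_max_left _ _).trans hy2)
    have hy3 := (le_max_right _ _).trans hy2
    rw [div_le_iff₀ (by positivity)] at hy3
    rw [dist_zero_right, norm_mul, norm_inv, norm_norm, inv_mul_lt_iff₀ hy0,
      Real.norm_eq_abs, abs_lt] at hy1
    rw [inv_mul_eq_div, le_div_iff₀ hy0]
    have h1 := hgrow y
    have h2 : δ * (‖y‖ - ‖x₀‖) ≤ δ * ‖y - x₀‖ :=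
      mul_le_mul_of_nonneg_left (norm_sub_norm_le y x₀) hδ.le
    have h3 := le_abs_self (w x₀)
    nlinarith [hy1.1]

/-! ### Operations on almost everywhere subsolutions -/

theorem ae_le_min {v₁ v₂ : Space n → ℝ} {K₁ K₂ : NNReal} (h₁ : LipschitzWith K₁ v₁)
    (h₂ : LipschitzWith K₂ v₂) {W : Set (Space n)} {μ : ℝ}
    (hv₁ : ∀ᵐ y, y ∈ W → H (gradient v₁ y) y ≤ μ) (hv₂ : ∀ᵐ y, y ∈ W → H (gradient v₂ y) y ≤ μ) :
    ∀ᵐ y, y ∈ W → H (gradient (fun x => min (v₁ x) (v₂ x)) y) y ≤ μ := by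
  filter_upwards [h₁.ae_differentiableAt, h₂.ae_differentiableAt,
    (h₁.min h₂).ae_differentiableAt, hv₁, hv₂] with y hd₁ hd₂ hd hy₁ hy₂ hyW
  rcases min_choice (v₁ y) (v₂ y) with h | h
  · rw [gradient_eq_of_isLocalMax hd hd₁ (Eventually.of_forall fun x => by
      simp only [h, sub_self, sub_nonpos, min_le_left])]
    exact hy₁ hyW
  · rw [gradient_eq_of_isLocalMax hd hd₂ (Eventually.of_forall fun x => by
      simp only [h, sub_self, sub_nonpos, min_le_right])]
    exact hy₂ hyW

theorem lipschitzWith_combination {v s : Space n → ℝ} {K L : NNReal} (hK : LipschitzWith K v)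
    (hL : LipschitzWith L s) (θ θ' : ℝ) :
    LipschitzWith (‖θ‖₊ * K + ‖θ'‖₊ * L) fun x => θ * v x + θ' * s x :=
  (((lipschitzWith_smul θ).comp hK).add ((lipschitzWith_smul θ').comp hL))

theorem ae_le_combination (hconv : ConvexInMomentum H) {v s : Space n → ℝ} {K L : NNReal}
    (hK : LipschitzWith K v) (hL : LipschitzWith L s) {W : Set (Space n)} {a b : ℝ}
    (hv : ∀ᵐ y, y ∈ W → H (gradient v y) y ≤ a) (hs : ∀ᵐ y, H (gradient s y) y ≤ b) {θ : ℝ}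
    (hθ₀ : 0 ≤ θ) (hθ₁ : θ ≤ 1) :
    ∀ᵐ y, y ∈ W → H (gradient (fun x => θ * v x + (1 - θ) * s x) y) y ≤ θ * a + (1 - θ) * b := by
  filter_upwards [hK.ae_differentiableAt, hL.ae_differentiableAt, hv, hs]
    with y hdv hds hvy hsy hyW
  rw [(hasGradientAt_add (hasGradientAt_const_mul hdv.hasGradientAt θ)
    (hasGradientAt_const_mul hds.hasGradientAt (1 - θ))).gradient]
  have h1 := (hconv y).2 (mem_univ (gradient v y)) (mem_univ (gradient s y)) hθ₀
    (sub_nonneg.2 hθ₁) (add_sub_cancel θ 1)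
  simp only [smul_eq_mul] at h1
  have h2 := mul_le_mul_of_nonneg_left (hvy hyW) hθ₀
  have h3 := mul_le_mul_of_nonneg_left hsy (sub_nonneg.2 hθ₁)
  linarith

theorem le_of_forall_combination_le {a b c : ℝ}
    (h : ∀ θ : ℝ, 0 < θ → θ < 1 → θ * a + (1 - θ) * b ≤ c) : a ≤ c := by
  have hc : Continuous fun θ : ℝ => θ * a + (1 - θ) * b := by fun_prop
  have ht : Tendsto (fun θ : ℝ => θ * a + (1 - θ) * b) (𝓝[<] 1) (𝓝 a) := by
    simpa using (hc.tendsto 1).mono_left nhdsWithin_le_nhds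
  refine le_of_tendsto ht ?_
  filter_upwards [Ioo_mem_nhdsLT (show (0 : ℝ) < 1 by norm_num)] with θ hθ
  exact h θ hθ.1 hθ.2

/-- A subsolution strictly below the level `μ`, asymptotic to the linear function of slope `p`. -/
theorem exists_strict_subsolution (hreg : UniformlyRegular H) {μ : ℝ} {p : Space n}
    (hμ : effectiveH H p < μ) (x₀ : Space n) :
    ∃ μ₀ < μ, ∃ (s : Space n → ℝ) (L : NNReal), LipschitzWith L s ∧
      (∀ᵐ y, H (gradient s y) y ≤ μ₀) ∧ s x₀ = 0 ∧
      ∀ ε > 0, ∃ R : ℝ, ∀ y, R ≤ ‖y‖ → s y - inner ℝ p (y - x₀) ≤ ε * ‖y‖ := by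
  obtain ⟨μ₀, ⟨w, ⟨L, hL⟩, hw, hlim⟩, hμ₀⟩ := exists_mem_subsolutionLevels_lt hreg hμ
  have hin : LipschitzWith ‖p‖₊ fun y => inner ℝ p (y - x₀) := by
    refine LipschitzWith.of_dist_le_mul fun a b => ?_
    rw [Real.dist_eq, ← inner_sub_right, sub_sub_sub_cancel_right, dist_eq_norm]
    exact abs_real_inner_le_norm _ _
  have hs : LipschitzWith (L + ‖p‖₊) fun y => w y + inner ℝ p (y - x₀) - w x₀ := by
    simpa using (hL.add hin).sub (LipschitzWith.const (w x₀))
  refine ⟨μ₀, hμ₀, _, _, hs, ?_, by simp, fun ε hε => ?_⟩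
  · filter_upwards [((hw.add_inner x₀).sub_const (w x₀)).ae_le hreg isOpen_univ hs] with y hy
    exact hy (mem_univ y)
  · obtain ⟨R, hR⟩ := exists_norm_le_imp_of_cocompact
      (hlim.eventually (Metric.ball_mem_nhds 0 (half_pos hε)))
    refine ⟨max (max R 1) (|w x₀| / (ε / 2)), fun y hy => ?_⟩
    have h1 : R ≤ ‖y‖ := ((le_max_left _ _).trans (le_max_left _ _)).trans hy
    have h2 : 1 ≤ ‖y‖ := ((le_max_right _ _).trans (le_max_left _ _)).trans hy
    have h3 := (le_max_right _ _).trans hy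
    have h4 := hR y h1
    have hy0 : 0 < ‖y‖ := by linarith
    rw [div_le_iff₀ (by positivity)] at h3
    rw [dist_zero_right, norm_mul, norm_inv, norm_norm, inv_mul_lt_iff₀ hy0,
      Real.norm_eq_abs, abs_lt] at h4
    have h5 := neg_abs_le (w x₀)
    linarith [h4.2]

/-! ### Uniqueness of distance functions -/

theorem IsDistanceFunction.continuous {μ : ℝ} {x₀ : Space n} {d : Space n → ℝ}
    (hd : IsDistanceFunction H μ x₀ d) : Continuous d := by
  obtain ⟨p, -, d', hd', hdd'⟩ := hd
  rw [funext hdd']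
  exact hd'.1.add (continuous_inner_sub p x₀)

theorem IsDistanceFunction.apply_vertex {μ : ℝ} {x₀ : Space n} {d : Space n → ℝ}
    (hd : IsDistanceFunction H μ x₀ d) : d x₀ = 0 := by
  obtain ⟨p, -, d', hd', hdd'⟩ := hd
  rw [hdd', hd'.2.1]
  simp

theorem IsDistanceFunction.isViscSolution {μ : ℝ} {x₀ : Space n} {d : Space n → ℝ}
    (hd : IsDistanceFunction H μ x₀ d) : IsViscSolution H μ {x₀}ᶜ d := by
  obtain ⟨p, -, d', hd', hdd'⟩ := hd
  rw [funext hdd']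
  exact ⟨hd'.2.2.1.1.add_inner x₀, hd'.2.2.1.2.add_inner x₀⟩

theorem IsDistanceFunction.exists_growth {μ : ℝ} {x₀ : Space n} {d : Space n → ℝ}
    (hd : IsDistanceFunction H μ x₀ d) :
    ∃ p, (∀ p', effectiveH H p ≤ effectiveH H p') ∧
      ∃ c > 0, ∃ R : ℝ, ∀ y, R ≤ ‖y‖ → c * ‖y‖ ≤ d y - inner ℝ p (y - x₀) := by
  obtain ⟨p, hp, d', hd', hdd'⟩ := hd
  obtain ⟨c, hc0, hc⟩ := EReal.lt_iff_exists_real_btwn.1 hd'.2.2.2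
  obtain ⟨R, hR⟩ := exists_norm_le_imp_of_cocompact (eventually_lt_of_lt_liminf hc)
  refine ⟨p, hp, c, by exact_mod_cast hc0, max R 1, fun y hy => ?_⟩
  have h1 := hR y ((le_max_left _ _).trans hy)
  have hy0 : 0 < ‖y‖ := lt_of_lt_of_le one_pos ((le_max_right _ _).trans hy)
  rw [EReal.coe_lt_coe_iff, inv_mul_eq_div, lt_div_iff₀ hy0] at h1
  rw [hdd']
  linarith

theorem IsDistanceFunction.exists_lipschitzWith (hcoer : CoerciveInMomentum H) {μ : ℝ}
    {x₀ : Space n} {d : Space n → ℝ} (hd : IsDistanceFunction H μ x₀ d) :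
    ∃ K, LipschitzWith K d := by
  obtain ⟨K, hK⟩ := hcoer.exists_bound μ
  exact ⟨K, hd.isViscSolution.1.lipschitzWith hK hd.continuous⟩

/-- The two functions may come from different minimizers of H̄, so `d₂ - d₁` is not controlled at
infinity; truncating `d₂` at `d₁ + 1` bounds it. The strict subsolution uses the slope `p` of `d₁`.
-/
theorem IsDistanceFunction.le (hconv : ConvexInMomentum H) (hcoer : CoerciveInMomentum H)
    (hreg : UniformlyRegular H) {μ : ℝ} (hμ : ∃ p, effectiveH H p < μ) {x₀ : Space n}
    {d₁ d₂ : Space n → ℝ} (h₁ : IsDistanceFunction H μ x₀ d₁) (h₂ : IsDistanceFunction H μ x₀ d₂)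
    (y : Space n) : d₂ y ≤ d₁ y := by
  obtain ⟨p, hp, c, hc, R₁, hR₁⟩ := h₁.exists_growth
  obtain ⟨K₁, hK₁⟩ := h₁.exists_lipschitzWith hcoer
  obtain ⟨K₂, hK₂⟩ := h₂.exists_lipschitzWith hcoer
  obtain ⟨p', hp'⟩ := hμ
  obtain ⟨μ₀, hμ₀, s, L, hL, hs, hs0, hsR⟩ :=
    exists_strict_subsolution hreg ((hp p').trans_lt hp') x₀
  obtain ⟨R₂, hR₂⟩ := hsR (c / 2) (by positivity)
  have hK₁' : LipschitzWith K₁ fun x => d₁ x + 1 := by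
    simpa using hK₁.add (LipschitzWith.const 1)
  set v : Space n → ℝ := fun x => min (d₂ x) (d₁ x + 1) with hv
  have hvL := hK₂.min hK₁'
  have hO : IsOpen ({x₀}ᶜ : Set (Space n)) := isOpen_compl_singleton
  have hvae : ∀ᵐ y, y ∈ ({x₀}ᶜ : Set (Space n)) → H (gradient v y) y ≤ μ := by
    refine ae_le_min hK₂ hK₁' (h₂.isViscSolution.1.ae_le hreg hO hK₂) ?_
    have h3 : IsViscSubsolution H μ {x₀}ᶜ fun x => d₁ x + 1 := by
      simpa using h₁.isViscSolution.1.sub_const (-1)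
    exact h3.ae_le hreg hO hK₁'
  have key : v y ≤ d₁ y := by
    refine le_of_forall_combination_le (b := s y) fun θ hθ₀ hθ₁ => ?_
    have hθ : 0 < 1 - θ := sub_pos.2 hθ₁
    -- The last entry makes the gain `(1 - θ) * (c / 2) * R` at least `θ`, the cost of the
    -- truncation.
    set R := max (max R₁ R₂) (max (‖y‖ + 1) (θ / ((1 - θ) * (c / 2)))) with hR
    have hRy : ‖y‖ < R := by
      have : ‖y‖ + 1 ≤ R := (le_max_left _ _).trans (le_max_right _ _)
      linarith
    have hout : ∀ x, R ≤ ‖x‖ → θ * v x + (1 - θ) * s x - d₁ x ≤ 0 := by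
      intro x hx
      have h1 := hR₁ x (((le_max_left _ _).trans (le_max_left _ _)).trans hx)
      have h2 := hR₂ x (((le_max_right _ _).trans (le_max_left _ _)).trans hx)
      have h3 := ((le_max_right _ _).trans (le_max_right _ _)).trans hx
      rw [div_le_iff₀ (by positivity)] at h3
      have h4 : v x ≤ d₁ x + 1 := min_le_right _ _
      have h5 : s x - d₁ x ≤ -(c / 2 * ‖x‖) := by linarith
      have h6 := mul_le_mul_of_nonneg_left h4 hθ₀.le
      have h7 := mul_le_mul_of_nonneg_left h5 hθ.le
      nlinarith
    have hx₀ : θ * v x₀ + (1 - θ) * s x₀ - d₁ x₀ ≤ 0 := by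
      simp [hv, hs0, h₁.apply_vertex, h₂.apply_vertex]
    rcases eq_or_ne y x₀ with rfl | hy
    · linarith
    set W : Set (Space n) := Metric.ball 0 R ∩ {x₀}ᶜ with hW
    have h := sub_le_of_strict_subsolution hconv hreg
      (lipschitzWith_combination hvL hL θ (1 - θ)) h₁.continuous
      (W := W) (Metric.isOpen_ball.inter hO) (Metric.isBounded_ball.subset inter_subset_left)
      inter_subset_right (c := θ * μ + (1 - θ) * μ₀) (μ := μ) (by nlinarith)
      (ae_le_combination hconv hvL hL (hvae.mono fun x hx hxW => hx hxW.2) hs hθ₀.le hθ₁.le)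
      h₁.isViscSolution.2 (k := 0) (fun x hx => by
        have hx' : x ∉ W := by
          rw [(Metric.isOpen_ball.inter hO).frontier_eq] at hx
          exact hx.2
        by_cases hxx : x = x₀
        · rw [hxx]
          exact hx₀
        · refine hout x ?_
          by_contra! hlt
          exact hx' ⟨mem_ball_zero_iff.2 hlt, hxx⟩)
      (y := y) ⟨mem_ball_zero_iff.2 hRy, hy⟩
    linarith
  rcases min_le_iff.1 key with h | h
  · exact h
  · linarith

theorem existsUnique_isDistanceFunction (hconv : ConvexInMomentum H) (hcoer : CoerciveInMomentum H)
    (hreg : UniformlyRegular H) {μ : ℝ} (hμ : ∃ p, effectiveH H p < μ) (x₀ : Space n) :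
    ∃! d, IsDistanceFunction H μ x₀ d := by
  obtain ⟨p, hp⟩ := exists_forall_effectiveH_le hcoer hreg
  obtain ⟨p', hp'⟩ := hμ
  obtain ⟨d, hd⟩ := exists_isDistanceFunction hcoer hreg hp ((hp p').trans_lt hp') x₀
  refine ⟨d, hd, fun d' hd' => funext fun y => le_antisymm ?_ ?_⟩
  · exact hd.le hconv hcoer hreg ⟨p', hp'⟩ hd' y
  · exact hd'.le hconv hcoer hreg ⟨p', hp'⟩ hd y

/-! ### Comparison with distance functions -/

theorem ae_le_of_energy_le {V : Set (Space n)} {u : Space n → ℝ} {μ : ℝ} (hV : IsOpen V)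
    (h : energy H V u ≤ μ) : ∀ᵐ y, y ∈ V → H (gradient u y) y ≤ μ := by
  rw [← ae_restrict_iff' hV.measurableSet]
  filter_upwards [ae_le_essSup (μ := volume.restrict V)
    (f := fun x => (H (gradient u x) x : EReal))] with y hy
  exact_mod_cast hy.trans h

theorem energy_le_of_ae_le {V : Set (Space n)} {u : Space n → ℝ} {μ : ℝ} (hV : IsOpen V)
    (h : ∀ᵐ y, y ∈ V → H (gradient u y) y ≤ μ) : energy H V u ≤ μ := by
  refine essSup_le_of_ae_le _ ?_
  filter_upwards [(ae_restrict_iff' hV.measurableSet).2 h] with y hy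
  exact_mod_cast hy

/-- In dimension zero `V` could be the whole compact space, with empty boundary. -/
theorem frontier_nonempty_of_isCompact_closure (hn : 1 ≤ n) {V : Set (Space n)}
    (hV : V.Nonempty) (hc : IsCompact (closure V)) : (frontier V).Nonempty := by
  have : Nonempty (Fin n) := ⟨⟨0, hn⟩⟩
  refine nonempty_frontier_iff.2 ⟨hV, ?_⟩
  rintro rfl
  rw [closure_univ] at hc
  exact noncompact_univ _ hc

/-- Subminimizers are at most any subsolution-supersolution `d` off `{x₀}` plus the maximum of the
difference over the boundary. -/
theorem IsAbsSubminimizer.sub_le (hconv : ConvexInMomentum H) (hreg : UniformlyRegular H)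
    {U : Set (Space n)} {u : Space n → ℝ} (hu : IsAbsSubminimizer H U u) {μ : ℝ}
    (hμ : ∃ p, effectiveH H p < μ) {O : Set (Space n)} (hO : IsOpen O) {d : Space n → ℝ}
    {K : NNReal} (hK : LipschitzWith K d) (hd : IsViscSolution H μ O d) {V : Set (Space n)}
    (hV : CompactlyInside V U) (hVO : V ⊆ O) {k : ℝ} (hk : ∀ x ∈ frontier V, u x - d x ≤ k)
    {x : Space n} (hx : x ∈ V) : u x - d x ≤ k := by
  obtain ⟨hVo, hVc, hVU⟩ := hV
  obtain ⟨L, hL⟩ := (hu.1.mono hVU).exists_lipschitzOnWith_of_compact hVc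
  -- Mollification needs a globally Lipschitz function, so `u` is replaced by an extension of its
  -- restriction to `closure V`.
  obtain ⟨g, hg, hgu⟩ := hL.extend_real
  have hgd : Continuous fun x => g x - d x := hg.continuous.sub hK.continuous
  set W : Set (Space n) := V ∩ {x | k < g x - d x} with hW
  have hWo : IsOpen W := hVo.inter (isOpen_lt continuous_const hgd)
  have hWV : closure W ⊆ closure V := closure_mono inter_subset_left
  have hfr : ∀ y ∈ frontier W, u y - d y = k := by
    intro y hy
    rw [hWo.frontier_eq] at hy
    have hyV : y ∈ closure V := hWV hy.1
    have h1 : k ≤ g y - d y := by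
      have hcl : IsClosed {x | k ≤ g x - d x} := isClosed_le continuous_const hgd
      exact closure_minimal (fun z hz => show k ≤ g z - d z from le_of_lt hz.2) hcl hy.1
    rw [hgu hyV]
    refine le_antisymm ?_ h1
    by_cases hyV' : y ∈ V
    · by_contra! hlt
      exact hy.2 ⟨hyV', hlt⟩
    · have := hk y (by rw [hVo.frontier_eq]; exact ⟨hyV, hyV'⟩)
      rwa [hgu hyV] at this
  have hdk : LipschitzWith K fun x => d x + k := by
    simpa using hK.add (LipschitzWith.const k)
  have hdkv : IsViscSubsolution H μ O fun x => d x + k := by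
    simpa using hd.1.sub_const (-k)
  have henergy : energy H W u ≤ μ := by
    refine (hu.2 W ⟨hWo, hVc.of_isClosed_subset isClosed_closure hWV, hWV.trans hVU⟩
      (fun x => d x + k) ⟨K, hdk.lipschitzOnWith⟩ (fun y hy => ?_) fun y hy => ?_).trans
      (energy_le_of_ae_le hWo ?_)
    · have h1 : k < g y - d y := hy.2
      rw [hgu (subset_closure hy.1)]
      linarith
    · have := hfr y hy
      linarith
    · exact (hdkv.ae_le hreg hO hdk).mono fun y hy hyW => hy (hVO hyW.1)
  have hgae : ∀ᵐ y, y ∈ W → H (gradient g y) y ≤ μ := by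
    filter_upwards [ae_le_of_energy_le hWo henergy] with y hy hyW
    have he : g =ᶠ[𝓝 y] u := by
      filter_upwards [hWo.mem_nhds hyW] with z hz
      exact (hgu (subset_closure hz.1)).symm
    rw [he.gradient_eq]
    exact hy hyW
  obtain ⟨p, hp⟩ := hμ
  obtain ⟨μ₀, hμ₀, s, L', hL', hs, -, -⟩ := exists_strict_subsolution hreg hp 0
  obtain ⟨B, hB⟩ := hVc.bddAbove_image (hL'.continuous.sub hK.continuous).continuousOn
  have hB' : ∀ y ∈ closure V, s y - d y ≤ B := fun y hy => hB (mem_image_of_mem _ hy)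
  by_contra! hlt
  rw [hgu (subset_closure hx)] at hlt
  have hxW : x ∈ W := ⟨hx, hlt⟩
  refine absurd hlt (not_lt.2 ?_)
  -- This `b` rearranges the comparison bound `θ * k + (1 - θ) * B` so that its right-hand side
  -- becomes `k`, independent of `θ`.
  refine le_of_forall_combination_le (b := s x - d x - B + k) fun θ hθ₀ hθ₁ => ?_
  have h := sub_le_of_strict_subsolution hconv hreg
    (lipschitzWith_combination hg hL' θ (1 - θ)) hK.continuous hWo
    (hVc.isBounded.subset (subset_closure.trans hWV)) (inter_subset_left.trans hVO)
    (c := θ * μ + (1 - θ) * μ₀) (μ := μ) (by nlinarith)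
    (ae_le_combination hconv hg hL' hgae hs hθ₀.le hθ₁.le) hd.2 (k := θ * k + (1 - θ) * B)
    (fun y hy => by
      have hyV : y ∈ closure V := hWV (frontier_subset_closure hy)
      have h1 := hfr y hy
      rw [hgu hyV] at h1
      have h2 := mul_le_mul_of_nonneg_left (hB' y hyV) (sub_nonneg.2 hθ₁.le)
      nlinarith) hxW
  linarith

theorem comparisonFromAbove (hn : 1 ≤ n) (hconv : ConvexInMomentum H)
    (hcoer : CoerciveInMomentum H) (hreg : UniformlyRegular H) {U : Set (Space n)}
    {u : Space n → ℝ} (hu : IsAbsSubminimizer H U u) : ComparisonFromAbove H U u := by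
  intro μ hμ V hV hVne x₀ hx₀
  have hμ' : ∃ p, effectiveH H p < μ := exists_lt_of_ciInf_lt hμ
  have hd : IsDistanceFunction H μ x₀ (distanceFunction H μ x₀) :=
    Classical.epsilon_spec (existsUnique_isDistanceFunction hconv hcoer hreg hμ' x₀).exists
  obtain ⟨K, hK⟩ := hd.exists_lipschitzWith hcoer
  have hcont : ContinuousOn (fun x => u x - distanceFunction H μ x₀ x) (closure V) :=
    (hu.1.continuousOn.mono hV.2.2).sub hK.continuous.continuousOn
  obtain ⟨y, hy, hmax⟩ := (hV.2.1.of_isClosed_subset isClosed_frontier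
    frontier_subset_closure).exists_isMaxOn
    (frontier_nonempty_of_isCompact_closure hn hVne hV.2.1) (hcont.mono frontier_subset_closure)
  refine ⟨_, ⟨mem_image_of_mem _ (frontier_subset_closure hy), ?_⟩, mem_image_of_mem _ hy, ?_⟩
  · rintro _ ⟨x, hx, rfl⟩
    by_cases hxV : x ∈ V
    · exact hu.sub_le hconv hreg hμ' isOpen_compl_singleton hK hd.isViscSolution hV
        (fun z hz hzx => hx₀ (hzx ▸ hz)) (fun z hz => hmax hz) hxV
    · exact hmax (by rw [hV.1.frontier_eq]; exact ⟨hx, hxV⟩)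
  · rintro _ ⟨x, hx, rfl⟩
    exact hmax hx

end LInfVar

end

theorem proposition3p5 {n : ℕ} (hn : 1 ≤ n)
    (H : LInfVar.Space n → LInfVar.Space n → ℝ)
    (hconv : LInfVar.ConvexInMomentum H)
    (hcoer : LInfVar.CoerciveInMomentum H)
    (hreg : LInfVar.UniformlyRegular H)
    (U : Set (LInfVar.Space n)) (hU : IsOpen U)
    (u : LInfVar.Space n → ℝ) (hu : LInfVar.IsAbsSubminimizer H U u) :
    (∀ μ : ℝ, (⨅ p, LInfVar.effectiveH H p) < μ → ∀ x₀ : LInfVar.Space n,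
      ∃! d : LInfVar.Space n → ℝ, LInfVar.IsDistanceFunction H μ x₀ d) ∧
    LInfVar.ComparisonFromAbove H U u :=
  ⟨fun _ hμ x₀ => LInfVar.existsUnique_isDistanceFunction hconv hcoer hreg
    (exists_lt_of_ciInf_lt hμ) x₀, LInfVar.comparisonFromAbove hn hconv hcoer hreg hu⟩
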